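/- **Lemma (DefEq regularity for System DR).** Let $\Sigma_0$ be a well-formed toplevel signature ($\vDash\Sigma_0$), $\Gamma$ a context, $\Delta$ a finite set of variables, $a,b,A$ terms and $R$ a role of System DR. If $\Gamma;\Delta\vDash a\equiv_R b:A$ is derivable over $\Sigma_0$, then $\Gamma\vDash a:A$ and $\Gamma\vDash b:A$ are derivable over $\Sigma_0$. So role-indexed definitional equality is homogeneous and relates only well-typed terms. The system is the following; terms are taken up to renaming of bound variables, and bound variables are chosen fresh. *Grammar.* Roles $R::=\mathsf{Nom}\mid\mathsf{Rep}$ with $\mathsf{Nom}\le\mathsf{Rep}$ and minimum $\wedge$; relevance $\rho::=+\mid-$; flags $\nu::=R\mid\rho$ and $\upsilon::=\nu\mid\bullet$ (a flag $\nu$ is relevant if $\nu\ne-$). Terms $a,b,A,B::=\star\mid x\mid F\mid\lambda^\rho x.b\mid a\,b^\nu\mid\Box\mid\Pi^\rho x{:}A\to B\mid\Lambda c.a\mid a\,\bullet\mid\forall c{:}\phi.B\mid\mathsf{case}\ a\ \mathsf{of}\ F\,\overline\upsilon\to b_1\,\|\,\_\to b_2$, where $\phi::=a\sim_R b:A$.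 Contexts $\Gamma::=\varnothing\mid\Gamma,x{:}A\mid\Gamma,c{:}\phi$, with domain $\widetilde\Gamma$. Patterns $p::=F\mid p\,x^R\mid p\,x^+\mid p\,\Box^-\mid p\,\bullet$. A signature is a finite list of declarations $F:A@\overline R$ (constants) and $F:A@\overline R\ \mathsf{where}\ p\sim_R a$ (axioms). *Paths and values.* A path is $w::=F\mid w\,b^\nu\ (\nu\text{ relevant})\mid w\,\Box^-\mid w\,\bullet$, with head $F$ declared in $\Sigma_0$. $\mathsf{Roles}(F)=\overline R$ if $F$ is declared with $@\overline R$; if $\mathsf{Roles}(a)=R,\overline R$ then $\mathsf{Roles}(a\,b^R)=\overline R$ and $\mathsf{Roles}(a\,b^+)=\overline R$; $\mathsf{Roles}(a\,\Box^-)=\mathsf{Roles}(a\,\bullet)=\mathsf{Roles}(a)$. A path matches $p$ if it has the shape of $p$, with the same flags and arbitrary terms in place of the variables of $p$. $\mathsf{CasePath}_R\,a=F$ holds if $a$ is a path with head $F$ and $F$ is a constant, or an axiom of role $R_1\not\le R$, or an axiom whose pattern is matched by no prefix of $a$. The values at $R$ are $\star$, $\Pi$- and $\forall$-types, $\lambda^+x.a$,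 $\Lambda c.a$, $\lambda^-x.a$ with $a$ a value at $R$, and all $a$ with $\mathsf{CasePath}_R\,a=F$ for some $F$. *Primitive reduction $\to^\beta_R$.* - $(\lambda^\rho x.v)\,b^\rho\to^\beta_R v\{b/x\}$ if $\lambda^\rho x.v$ is a value at $R$; $(\Lambda c.a)\,\bullet\to^\beta_R a$. - If $F:A@\overline R\ \mathsf{where}\ p\sim_{R_1}b$ is in $\Sigma_0$, $R_1\le R$, and $a$ matches $p$, then $a\to^\beta_R b'$, where $b'$ is $b$ with the matched arguments substituted for the variables of $p$. - Write $a\leftrightarrow F\,\overline\upsilon$ if $a$ is a path with head $F$ whose arguments carry the flags $\overline\upsilon$, and $F$ is a constant or an axiom of role $\mathsf{Rep}$. Call $F\,\overline\upsilon$ saturated if the relevant flags in $\overline\upsilon$ are the declared roles of $F$ in order, where $+$ may stand for any role. For saturated $F\,\overline\upsilon$, $\mathsf{case}\ a\ \mathsf{of}\ F\,\overline\upsilon\to b_1\|\_\to b_2$ reduces, at every role, to $b_1'\,\bullet$ if $a\leftrightarrow F\,\overline\upsilon$, where $b_1'$ is $b_1$ applied to the arguments of $a$ with role flags replaced by $+$;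 and to $b_2$ if $a$ is a value at $\mathsf{Nom}$ and not $a\leftrightarrow F\,\overline\upsilon$. *Branch types.* $\mathsf{Br}_{\overline\upsilon}(a:A;\,b:T)=B\mid C$ is defined by: $\mathsf{Br}_{\varnothing}(a:A;b:A)=\forall c{:}(a\sim_{\mathsf{Nom}}b:A).C\mid C$; $\mathsf{Br}_{\nu,\overline\upsilon}(a:A;b:\Pi^+x{:}A'\to T)=\Pi^+x{:}A'\to B\mid C$ for relevant $\nu$ if $\mathsf{Br}_{\overline\upsilon}(a:A;b\,x^\nu:T)=B\mid C$; $\mathsf{Br}_{-,\overline\upsilon}(a:A;b:\Pi^-x{:}A'\to T)=\Pi^-x{:}A'\to B\mid C$ if $\mathsf{Br}_{\overline\upsilon}(a:A;b\,\Box^-:T)=B\mid C$; $\mathsf{Br}_{\bullet,\overline\upsilon}(a:A;b:\forall c{:}\phi.T)=\forall c{:}\phi.B\mid C$ if $\mathsf{Br}_{\overline\upsilon}(a:A;b\,\bullet:T)=B\mid C$; here $x\notin\mathrm{fv}(a,A,b,C)$. The judgments below are defined by simultaneous induction. Premises in square brackets are part of the rules although they are redundant. *Contexts $\vDash\Gamma$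 and propositions.* $\vDash\varnothing$; $\vDash\Gamma,x{:}A$ if $\vDash\Gamma$, $\Gamma\vDash A:\star$, $x\notin\widetilde\Gamma$; $\vDash\Gamma,c{:}\phi$ if $\vDash\Gamma$, $\Gamma\vDash\phi\ \mathsf{ok}$, $c\notin\widetilde\Gamma$. $\Gamma\vDash(a\sim_Rb:A)\ \mathsf{ok}$ if $\Gamma\vDash a:A$, $\Gamma\vDash b:A$, $[\Gamma\vDash A:\star]$. *Typing $\Gamma\vDash a:A$.* - $\Gamma\vDash\star:\star$ if $\vDash\Gamma$; $\Gamma\vDash x:A$ if $\vDash\Gamma$ and $x{:}A\in\Gamma$; $\Gamma\vDash F:A$ if $\vDash\Gamma$, $F$ is declared in $\Sigma_0$ (as constant or axiom) with type $A$, and $[\varnothing\vDash A:\star]$. - $\Gamma\vDash\Pi^\rho x{:}A\to B:\star$ if $\Gamma,x{:}A\vDash B:\star$, $[\Gamma\vDash A:\star]$. $\Gamma\vDash\lambda^\rho x.a:\Pi^\rho x{:}A\to B$ if $\Gamma,x{:}A\vDash a:B$, $[\Gamma\vDash A:\star]$, and $x\notin\mathrm{fv}(a)$ when $\rho=-$.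 - If $\Gamma\vDash b:\Pi^+x{:}A\to B$ and $\Gamma\vDash a:A$, then $\Gamma\vDash b\,a^+:B\{a/x\}$, and $\Gamma\vDash b\,a^R:B\{a/x\}$ if moreover $\mathsf{Roles}(b)=R,\overline R$. If $\Gamma\vDash b:\Pi^-x{:}A\to B$ and $\Gamma\vDash a:A$, then $\Gamma\vDash b\,\Box^-:B\{a/x\}$. - $\Gamma\vDash\forall c{:}\phi.B:\star$ if $\Gamma,c{:}\phi\vDash B:\star$, $[\Gamma\vDash\phi\ \mathsf{ok}]$. $\Gamma\vDash\Lambda c.a:\forall c{:}\phi.B$ if $\Gamma,c{:}\phi\vDash a:B$, $[\Gamma\vDash\phi\ \mathsf{ok}]$. $\Gamma\vDash a_1\,\bullet:B$ if $\Gamma\vDash a_1:\forall c{:}(a\sim_Rb:A).B$ and $\Gamma;\widetilde\Gamma\vDash a\equiv_Rb:A$. - $\Gamma\vDash a:B$ if $\Gamma\vDash a:A$, $\Gamma;\widetilde\Gamma\vDash A\equiv_{\mathsf{Rep}}B:\star$, $[\Gamma\vDash B:\star]$. - $\Gamma\vDash\mathsf{case}\ a\ \mathsf{of}\ F\,\overline\upsilon\to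 b_1\|\_\to b_2:C$ if $\Gamma\vDash a:A$, $\Gamma\vDash b_1:B$, $\Gamma\vDash b_2:C$, $\Gamma\vDash F:A_1$, $\mathsf{Br}_{\overline\upsilon}(a:A;F:A_1)=B\mid C$, and $F\,\overline\upsilon$ is saturated. *Equality of propositions $\Gamma;\Delta\vDash\phi_1\equiv\phi_2$.* - $(a\sim_Rb:A)\equiv(a'\sim_Rb':A)$ if $\Gamma;\Delta\vDash a\equiv_Ra':A$ and $\Gamma;\Delta\vDash b\equiv_Rb':A$. - $(a\sim_Rb:A)\equiv(a\sim_Rb:B)$ if $\Gamma;\Delta\vDash A\equiv_{\mathsf{Rep}}B:\star$ and both are $\mathsf{ok}$ in $\Gamma$. - $\phi_1\equiv\phi_2$ if $\Gamma;\Delta\vDash\forall c{:}\phi_1.B_1\equiv_R\forall c{:}\phi_2.B_2:\star$. *Definitional equality $\Gamma;\Delta\vDash a\equiv_Rb:A$* (unless indicated otherwise, equalities in the premises are over $\Gamma;\Delta$ too). - Assumption: $a\equiv_Rb:A$ if $\vDash\Gamma$, $c{:}(a\sim_Rb:A)\in\Gamma$, $c\in\Delta$. Reflexivity on $\Gamma\vDash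 a:A$, symmetry, transitivity. From $a\equiv_{R_1}b:A$ and $R_1\le R_2$ infer $a\equiv_{R_2}b:A$. - $a_1\equiv_Ra_2:B$ if $\Gamma\vDash a_1:B$, $[\Gamma\vDash a_2:B]$, $a_1\to^\beta_Ra_2$. - $\Pi^\rho x{:}A_1\to B_1\equiv_R\Pi^\rho x{:}A_2\to B_2:\star$ if $A_1\equiv_RA_2:\star$, $\Gamma,x{:}A_1;\Delta\vDash B_1\equiv_RB_2:\star$, $[\Gamma\vDash A_1:\star]$, and $[$both $\Pi$-types have type $\star$ in $\Gamma]$. - $\lambda^\rho x.b_1\equiv_R\lambda^\rho x.b_2:\Pi^\rho x{:}A\to B$ if $\Gamma,x{:}A;\Delta\vDash b_1\equiv_Rb_2:B$, $[\Gamma\vDash A:\star]$, and $x\notin\mathrm{fv}(b_1)\cup\mathrm{fv}(b_2)$ when $\rho=-$. - If $a_1\equiv_{R'}b_1:\Pi^+x{:}A\to B$: $a_1\,a_2^+\equiv_{R'}b_1\,b_2^+:B\{a_2/x\}$ if $a_2\equiv_{\mathsf{Nom}}b_2:A$; and $a_1\,a_2^R\equiv_{R'}b_1\,b_2^R:B\{a_2/x\}$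 if $a_2\equiv_{R\wedge R'}b_2:A$, $\mathsf{Roles}(a_1)=R,\overline R$, $\mathsf{Roles}(b_1)=R,\overline{R'}$, and $\Gamma\vDash b_1\,b_2^R:B\{a_2/x\}$. - $a_1\,\Box^-\equiv_Rb_1\,\Box^-:B\{a/x\}$ if $a_1\equiv_Rb_1:\Pi^-x{:}A\to B$ and $\Gamma\vDash a:A$. - If $\Pi^\rho x{:}A_1\to B_1\equiv_R\Pi^\rho x{:}A_2\to B_2:\star$, then $A_1\equiv_RA_2:\star$; and if also $a_1\equiv_{\mathsf{Nom}}a_2:A_1$, then $B_1\{a_1/x\}\equiv_RB_2\{a_2/x\}:\star$. - $\forall c{:}\phi_1.B_1\equiv_R\forall c{:}\phi_2.B_2:\star$ if $\Gamma;\Delta\vDash\phi_1\equiv\phi_2$, $\Gamma,c{:}\phi_1;\Delta\vDash B_1\equiv_RB_2:\star$, $[\Gamma\vDash\phi_1\ \mathsf{ok}]$, $[$both $\forall$-types have type $\star$ in $\Gamma]$. $\Lambda c.a\equiv_R\Lambda c.b:\forall c{:}\phi.B$ if $\Gamma,c{:}\phi;\Delta\vDash a\equiv_Rb:B$, $[\Gamma\vDash\phi\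 \mathsf{ok}]$. - $a_1\,\bullet\equiv_{R'}b_1\,\bullet:B$ if $a_1\equiv_{R'}b_1:\forall c{:}(a\sim_Rb:A).B$ and $\Gamma;\widetilde\Gamma\vDash a\equiv_Rb:A$. - $B_1\equiv_{R_0}B_2:\star$ if $\forall c{:}(a_1\sim_Ra_2:A).B_1\equiv_{R_0}\forall c{:}(a_1'\sim_{R'}a_2':A').B_2:\star$, $\Gamma;\widetilde\Gamma\vDash a_1\equiv_Ra_2:A$ and $\Gamma;\widetilde\Gamma\vDash a_1'\equiv_{R'}a_2':A'$. - From $\Gamma;\Delta\vDash(a\sim_Rb:A)\equiv(a'\sim_{R'}b':A')$ infer $A\equiv_{\mathsf{Rep}}A':\star$; and from this together with $a\equiv_Rb:A$ infer $a'\equiv_{R'}b':A'$. - From $a\equiv_Rb:A$ and $\Gamma;\widetilde\Gamma\vDash A\equiv_{\mathsf{Rep}}B:\star$ infer $a\equiv_Rb:B$. - $\mathsf{case}\ a\ \mathsf{of}\ F\,\overline\upsilon\to b_1\|\_\to b_2\equiv_R\mathsf{case}\ a'\ \mathsf{of}\ F\,\overline\upsilon\to b_1'\|\_\to b_2':C$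 if $a\equiv_{\mathsf{Nom}}a':A$, $b_1\equiv_Rb_1':B$, $b_2\equiv_Rb_2':C$, $\Gamma\vDash F:A_1$, $\mathsf{Br}_{\overline\upsilon}(a:A;F:A_1)=B\mid C$, $\mathsf{Br}_{\overline\upsilon}(a':A;F:A_1)=B'\mid C$, $[\Gamma;\widetilde\Gamma\vDash B\equiv_{\mathsf{Rep}}B':\star]$, and $F\,\overline\upsilon$ is saturated. - Suppose $\mathsf{CasePath}_{R_2}(a\,b^{R_1})=F$ and $\mathsf{CasePath}_{R_2}(a'\,b'^{R_1})=F$; $a,a'$ have type $\Pi^+x{:}A\to B$ and $b,b'$ have type $A$ in $\Gamma$; $a\,b^{R_1}\equiv_{R_2}a'\,b'^{R_1}:B\{b/x\}$; and $\Gamma;\widetilde\Gamma\vDash B\{b/x\}\equiv_{\mathsf{Rep}}B\{b'/x\}:\star$. Then $a\equiv_{R_2}a':\Pi^+x{:}A\to B$ and $b\equiv_{R_1\wedge R_2}b':A$. With $\Pi^-$ in place of $\Pi^+$, and $a\,\Box^-$, $a'\,\Box^-$ in place of $a\,b^{R_1}$, $a'\,b'^{R_1}$, the same premises give $a\equiv_{R_2}a':\Pi^-x{:}A\to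 B$. - If $\mathsf{CasePath}_{R'}(a\,\bullet)=F=\mathsf{CasePath}_{R'}(a'\,\bullet)$, $a,a'$ have type $\forall c{:}(a_1\sim_Ra_2:A).B$ in $\Gamma$, $\Gamma;\widetilde\Gamma\vDash a_1\equiv_Ra_2:A$ and $a\,\bullet\equiv_{R'}a'\,\bullet:B$, then $a\equiv_{R'}a':\forall c{:}(a_1\sim_Ra_2:A).B$. *Role-checking $\Omega\vDash a:R$,* where $\Omega$ assigns roles to variables. $\star$, $\Box$ and declared $F$ check at every role; $x$ checks at every $R\ge\Omega(x)$; $\lambda^\rho x.a$ and $\Pi^\rho x{:}A\to B$ check at $R$ if $a$, respectively $B$, checks at $R$ under $\Omega,x{:}\mathsf{Nom}$ and $A$ checks at $R$ under $\Omega$; $a\,b^\rho$ at $R$ if $a$ does and $b$ checks at $\mathsf{Nom}$; $a\,b^{R_1}$ at $R$ if $a$ does, $\mathsf{Roles}(a)=R_1,\overline R$ and $b$ checks at $R_1\wedge R$; $\Lambda c.a$ and $a\,\bullet$ at $R$ if $a$ does; $\forall c{:}(a\sim_{R_1}b:A).B$ at $R$ if $a,b$ check at $R_1$, $A$ at $\mathsf{Rep}$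 and $B$ at $R$; a case expression at $R$ if its scrutinee checks at $\mathsf{Nom}$ and its branches at $R$. *Signatures.* $\vDash\Sigma_0$ means that no constant is declared twice, that every declared type $A$ satisfies $\varnothing\vDash A:\star$, and that for every axiom $F:A@\overline R\ \mathsf{where}\ p\sim_Ra$ there are $\Gamma,B,\Omega$ with $\mathsf{PatCtx}(p,F:A)=\Gamma;B;\Omega$, $\Gamma\vDash a:B$, $\Omega\vDash a:R$, and $\overline R$ is the list of roles in $\Omega$ in the order of the pattern; here all judgments are over the whole of $\Sigma_0$. $\mathsf{PatCtx}(F,F:A)=\varnothing;A;\varnothing$. If $\mathsf{PatCtx}(p,F:A)=\Gamma;\Pi^+x{:}A'\to B;\Omega$, then $p\,x^R$ gives $\Gamma,x{:}A';B;\Omega,x{:}R$ and $p\,x^+$ gives $\Gamma,x{:}A';B;\Omega,x{:}\mathsf{Nom}$; if it is $\Gamma;\Pi^-x{:}A'\to B;\Omega$, then $p\,\Box^-$ gives $\Gamma,x{:}A';B;\Omega$; if it is $\Gamma;\forall c{:}\phi.B;\Omega$, then $p\,\bullet$ gives $\Gamma,c{:}\phi;B;\Omega$; the new variable is always fresh for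 $\Gamma$. -/

import Mathlib

/-!
System DR: a Curry-style dependent type theory with role-indexed definitional equality, in a
locally nameless representation.  Names of term variables, of coercion variables and of constants
are natural numbers; term and coercion variables share one name space, since a typing context
binds both.
-/

namespace SystemDR

/-- Roles: `nom` is the bottom and `rep` the top of the lattice. -/
inductive Role where
  | nom
  | rep

/-- The order `R₁ ≤ R₂` on roles. -/
inductive SubRole : Role → Role → Prop where
  | nomBot (R : Role) : SubRole .nom R
  | repTop (R : Role) : SubRole R .rep
  | refl (R : Role) : SubRole R R
  | trans {R₁ R₂ R₃ : Role} : SubRole R₁ R₂ → SubRole R₂ R₃ → SubRole R₁ R₃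

/-- The minimum `R₁ ∧ R₂` of two roles. -/
def Role.min : Role → Role → Role
  | .rep, .rep => .rep
  | _, _ => .nom

/-- Relevance `ρ ::= + | -`. -/
inductive Relevance where
  | rel
  | irr

/-- Application flags for term arguments, `ν ::= R | ρ`. -/
inductive Flag where
  | role (R : Role)
  | rho (ρ : Relevance)

/-- Application flags for arbitrary arguments, `υ ::= ν | •`. -/
inductive AnyFlag where
  | tm (ν : Flag)
  | co

/-- The flags that mark a relevant argument: a role, or `+`. -/
inductive Flag.Relevant : Flag → Prop where
  | role (R : Role) : Flag.Relevant (.role R)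
  | plus : Flag.Relevant (.rho .rel)

/-- Terms and types.  `bvar` is a de Bruijn index, bound by `abs` and by the codomain of `pi`.
`cpi a b A R B` is the type `∀ c : (a ∼_R b : A). B`, `cabs b` is `Λ c. b` and `capp a` is `a •`.
Coercion variables are bound by `cabs` and `cpi`, but the grammar of terms has no occurrences of
them (the argument of a coercion application is elided), so these binders carry no index and
instantiating them is the identity. -/
inductive Tm where
  | star
  | bvar (i : ℕ)
  | fvar (x : ℕ)
  | fam (F : ℕ)
  | abs (ρ : Relevance) (b : Tm)
  | app (a : Tm) (ν : Flag) (b : Tm)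
  | box
  | pi (ρ : Relevance) (A B : Tm)
  | cabs (b : Tm)
  | capp (a : Tm)
  | cpi (a b A : Tm) (R : Role) (B : Tm)
  | case (a : Tm) (F : ℕ) (υs : List AnyFlag) (b₁ b₂ : Tm)

/-- Equality propositions `φ ::= a ∼_R b : A`. -/
structure Constr where
  lhs : Tm
  rhs : Tm
  ty : Tm
  role : Role

/-- Replace the bound index `k` by `u`. -/
def Tm.openRec (u : Tm) : ℕ → Tm → Tm
  | _, .star => .star
  | k, .bvar i => if i = k then u else .bvar i
  | _, .fvar x => .fvar x
  | _, .fam F => .fam F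
  | k, .abs ρ b => .abs ρ (Tm.openRec u (k + 1) b)
  | k, .app a ν b => .app (Tm.openRec u k a) ν (Tm.openRec u k b)
  | _, .box => .box
  | k, .pi ρ A B => .pi ρ (Tm.openRec u k A) (Tm.openRec u (k + 1) B)
  | k, .cabs b => .cabs (Tm.openRec u k b)
  | k, .capp a => .capp (Tm.openRec u k a)
  | k, .cpi a b A R B =>
      .cpi (Tm.openRec u k a) (Tm.openRec u k b) (Tm.openRec u k A) R (Tm.openRec u k B)
  | k, .case a F υs b₁ b₂ =>
      .case (Tm.openRec u k a) F υs (Tm.openRec u k b₁) (Tm.openRec u k b₂)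

/-- `B.inst u` is `B{u/x}`, where `x` is the outermost bound variable of `B`. -/
def Tm.inst (B u : Tm) : Tm := Tm.openRec u 0 B

/-- `B.at x` is the body `B` with its outermost bound variable named `x`. -/
def Tm.at (B : Tm) (x : ℕ) : Tm := B.inst (.fvar x)

/-- All bound indices are below `k`, relative to the binders above the term. -/
def Tm.LcAt : ℕ → Tm → Prop
  | _, .star => True
  | k, .bvar i => i < k
  | _, .fvar _ => True
  | _, .fam _ => True
  | k, .abs _ b => Tm.LcAt (k + 1) b
  | k, .app a _ b => Tm.LcAt k a ∧ Tm.LcAt k b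
  | _, .box => True
  | k, .pi _ A B => Tm.LcAt k A ∧ Tm.LcAt (k + 1) B
  | k, .cabs b => Tm.LcAt k b
  | k, .capp a => Tm.LcAt k a
  | k, .cpi a b A _ B => Tm.LcAt k a ∧ Tm.LcAt k b ∧ Tm.LcAt k A ∧ Tm.LcAt k B
  | k, .case a _ _ b₁ b₂ => Tm.LcAt k a ∧ Tm.LcAt k b₁ ∧ Tm.LcAt k b₂

/-- Locally closed: the term has no dangling index, i.e. it represents a term of the language. -/
def Tm.Lc (a : Tm) : Prop := a.LcAt 0

/-- Free variables. -/
def Tm.fv : Tm → Finset ℕ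
  | .star => ∅
  | .bvar _ => ∅
  | .fvar x => {x}
  | .fam _ => ∅
  | .abs _ b => b.fv
  | .app a _ b => a.fv ∪ b.fv
  | .box => ∅
  | .pi _ A B => A.fv ∪ B.fv
  | .cabs b => b.fv
  | .capp a => a.fv
  | .cpi a b A _ B => a.fv ∪ b.fv ∪ A.fv ∪ B.fv
  | .case a _ _ b₁ b₂ => a.fv ∪ b₁.fv ∪ b₂.fv

/-- Simultaneous substitution of terms for free variables. -/
def Tm.msubst (σ : List (ℕ × Tm)) : Tm → Tm
  | .star => .star
  | .bvar i => .bvar i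
  | .fvar x => (σ.lookup x).getD (.fvar x)
  | .fam F => .fam F
  | .abs ρ b => .abs ρ (b.msubst σ)
  | .app a ν b => .app (a.msubst σ) ν (b.msubst σ)
  | .box => .box
  | .pi ρ A B => .pi ρ (A.msubst σ) (B.msubst σ)
  | .cabs b => .cabs (b.msubst σ)
  | .capp a => .capp (a.msubst σ)
  | .cpi a b A R B => .cpi (a.msubst σ) (b.msubst σ) (A.msubst σ) R (B.msubst σ)
  | .case a F υs b₁ b₂ => .case (a.msubst σ) F υs (b₁.msubst σ) (b₂.msubst σ)

/-- Signature entries: `const A Rs` declares `F : A @ Rs`, and `ax p a A R Rs` declares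
`F : A @ Rs where p ∼_R a`.  The pattern `p` is a term of the shape
`p ::= F | p x^R | p x^+ | p □^- | p •`, enforced by `PatCtx`. -/
inductive SigEntry where
  | const (A : Tm) (Rs : List Role)
  | ax (p a A : Tm) (R : Role) (Rs : List Role)

abbrev Signature := List (ℕ × SigEntry)

/-- Context entries `x : A` and `c : φ`. -/
inductive Binding where
  | tm (A : Tm)
  | co (φ : Constr)

/-- Contexts; the most recent entry comes first. -/
abbrev Context := List (ℕ × Binding)

/-- The set of all variables bound by a context. -/
def Context.dom (Γ : Context) : Finset ℕ := (Γ.map Prod.fst).toFinset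

/-! ### Paths, values and primitive reduction -/

/-- `Roles(a) = Rs`: the roles of the parameters that the constant-headed application `a` still
expects.  An argument flagged `+` takes the place of one with a role annotation. -/
inductive RolePath (S : Signature) : Tm → List Role → Prop where
  | absConst {F A Rs} : (F, .const A Rs) ∈ S → RolePath S (.fam F) Rs
  | const {F p a A R Rs} : (F, .ax p a A R Rs) ∈ S → RolePath S (.fam F) Rs
  | tapp {a b R Rs} : RolePath S a (R :: Rs) → RolePath S (.app a (.role R) b) Rs
  | app {a b R Rs} : RolePath S a (R :: Rs) → RolePath S (.app a (.rho .rel) b) Rs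
  | iapp {a Rs} : RolePath S a Rs → RolePath S (.app a (.rho .irr) .box) Rs
  | capp {a Rs} : RolePath S a Rs → RolePath S (.capp a) Rs

/-- The term is an application path headed by the constant `F`. -/
inductive ValuePath (S : Signature) : Tm → ℕ → Prop where
  | absConst {F A Rs} : (F, .const A Rs) ∈ S → ValuePath S (.fam F) F
  | const {F p a A R Rs} : (F, .ax p a A R Rs) ∈ S → ValuePath S (.fam F) F
  | app {a ν b F} : ν.Relevant → b.Lc → ValuePath S a F → ValuePath S (.app a ν b) F
  | iapp {a F} : ValuePath S a F → ValuePath S (.app a (.rho .irr) .box) F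
  | capp {a F} : ValuePath S a F → ValuePath S (.capp a) F

/-- The term has exactly the shape of the pattern. -/
inductive TmPatternAgree : Tm → Tm → Prop where
  | const {F} : TmPatternAgree (.fam F) (.fam F)
  | app {a p ν b x} : ν.Relevant → b.Lc → TmPatternAgree a p →
      TmPatternAgree (.app a ν b) (.app p ν (.fvar x))
  | iapp {a p} : TmPatternAgree a p →
      TmPatternAgree (.app a (.rho .irr) .box) (.app p (.rho .irr) .box)
  | capp {a p} : TmPatternAgree a p → TmPatternAgree (.capp a) (.capp p)

/-- Some prefix of the term has the shape of the pattern. -/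
inductive SubTmPatternAgree : Tm → Tm → Prop where
  | base {a p} : TmPatternAgree a p → SubTmPatternAgree a p
  | app {a p ν b} : b.Lc → SubTmPatternAgree a p → SubTmPatternAgree (.app a ν b) p
  | capp {a p} : SubTmPatternAgree a p → SubTmPatternAgree (.capp a) p

/-- `CasePath_R a = F`: `a` is a path headed by `F` that cannot reduce at role `R`, because `F` is
a constant, or because its axiom is opaque at `R`, or because its pattern is not matched. -/
inductive CasePath (S : Signature) : Role → Tm → ℕ → Prop where
  | absConst {R a F A Rs} : ValuePath S a F → (F, .const A Rs) ∈ S → CasePath S R a F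
  | const {R a F p b A R₁ Rs} : ValuePath S a F → (F, .ax p b A R₁ Rs) ∈ S → ¬ SubRole R₁ R →
      CasePath S R a F
  | unMatch {R a F p b A R₁ Rs} : ValuePath S a F → (F, .ax p b A R₁ Rs) ∈ S →
      ¬ SubTmPatternAgree a p → CasePath S R a F

/-- `Value_R a`. -/
inductive Value (S : Signature) : Role → Tm → Prop where
  | star {R} : Value S R .star
  | pi {R ρ A B} : (Tm.pi ρ A B).Lc → Value S R (.pi ρ A B)
  | cpi {R a b A R₁ B} : (Tm.cpi a b A R₁ B).Lc → Value S R (.cpi a b A R₁ B)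
  | absRel {R a} : (Tm.abs .rel a).Lc → Value S R (.abs .rel a)
  | absIrrel {R a} (L : Finset ℕ) : (∀ x ∉ L, Value S R (a.at x)) → Value S R (.abs .irr a)
  | cabs {R a} : (Tm.cabs a).Lc → Value S R (.cabs a)
  | path {R a F} : CasePath S R a F → Value S R a

/-- `PatMatch a p σ`: the term `a` matches the pattern `p`, and `σ` assigns to each variable of
`p` the argument of `a` in its position. -/
inductive PatMatch : Tm → Tm → List (ℕ × Tm) → Prop where
  | const {F} : PatMatch (.fam F) (.fam F) []
  | app {a p ν b x σ} : ν.Relevant → b.Lc → PatMatch a p σ →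
      PatMatch (.app a ν b) (.app p ν (.fvar x)) ((x, b) :: σ)
  | iapp {a p σ} : PatMatch a p σ →
      PatMatch (.app a (.rho .irr) .box) (.app p (.rho .irr) .box) σ
  | capp {a p σ} : PatMatch a p σ → PatMatch (.capp a) (.capp p) σ

/-- `MatchSubst(a, p, b) = b'`.  The variables of `p` are bound in `b`; substituting for all of
them at once makes it unnecessary to rename them apart from the variables of `a`. -/
def MatchSubst (a p b b' : Tm) : Prop := ∃ σ, PatMatch a p σ ∧ b' = b.msubst σ

/-- `a ↔_R F υs`: `a` is a path headed by `F`, with `F` not unfoldable at role `R`, whose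
arguments carry exactly the flags `υs`. -/
inductive AppsPath (S : Signature) (R : Role) : Tm → ℕ → List AnyFlag → Prop where
  | absConst {F A Rs} : (F, .const A Rs) ∈ S → AppsPath S R (.fam F) F []
  | const {F p b A R₁ Rs} : (F, .ax p b A R₁ Rs) ∈ S → ¬ SubRole R₁ R → AppsPath S R (.fam F) F []
  | app {a ν b F υs} : ν.Relevant → b.Lc → AppsPath S R a F υs →
      AppsPath S R (.app a ν b) F (υs ++ [.tm ν])
  | iapp {a F υs} : AppsPath S R a F υs →
      AppsPath S R (.app a (.rho .irr) .box) F (υs ++ [.tm (.rho .irr)])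
  | capp {a F υs} : AppsPath S R a F υs → AppsPath S R (.capp a) F (υs ++ [.co])

/-- `ApplyArgs a b b'`: `b'` is `b` applied to the arguments of the path `a`.  Role annotations
become `+`, since `b` need not be headed by a constant. -/
inductive ApplyArgs : Tm → Tm → Tm → Prop where
  | const {F b} : b.Lc → ApplyArgs (.fam F) b b
  | tapp {a R c b b'} : c.Lc → ApplyArgs a b b' →
      ApplyArgs (.app a (.role R) c) b (.app b' (.rho .rel) c)
  | app {a ρ c b b'} : c.Lc → ApplyArgs a b b' →
      ApplyArgs (.app a (.rho ρ) c) b (.app b' (.rho ρ) c)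
  | capp {a b b'} : ApplyArgs a b b' → ApplyArgs (.capp a) b (.capp b')

/-- The relevant flags among `υs` supply exactly the parameters with roles `Rs`. -/
inductive AppRoles : List AnyFlag → List Role → Prop where
  | nil : AppRoles [] []
  | tapp {R υs Rs} : AppRoles υs Rs → AppRoles (.tm (.role R) :: υs) (R :: Rs)
  | app {R υs Rs} : AppRoles υs Rs → AppRoles (.tm (.rho .rel) :: υs) (R :: Rs)
  | iapp {υs Rs} : AppRoles υs Rs → AppRoles (.tm (.rho .irr) :: υs) Rs
  | capp {υs Rs} : AppRoles υs Rs → AppRoles (.co :: υs) Rs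

/-- The flags `υs` saturate the role-annotated parameters of `F`. -/
inductive SatApp (S : Signature) : ℕ → List AnyFlag → Prop where
  | const {F A Rs υs} : (F, .const A Rs) ∈ S → AppRoles υs Rs → SatApp S F υs
  | ax {F p a A R Rs υs} : (F, .ax p a A R Rs) ∈ S → AppRoles υs Rs → SatApp S F υs

/-- Primitive reduction: `Beta S a b R` is `⊨ a →β_R b`. -/
inductive Beta (S : Signature) : Tm → Tm → Role → Prop where
  | appAbs {R ρ v b} : Value S R (.abs ρ v) → b.Lc →
      Beta S (.app (.abs ρ v) (.rho ρ) b) (v.inst b) R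
  | cappCAbs {R a} : a.Lc → Beta S (.capp (.cabs a)) a R
  | axiomStep {R F p b A R₁ Rs a b'} : (F, .ax p b A R₁ Rs) ∈ S → MatchSubst a p b b' →
      SubRole R₁ R → Beta S a b' R
  | patternTrue {R a F υs b₁ b₂ b₁'} : AppsPath S .nom a F υs → ApplyArgs a b₁ b₁' →
      SatApp S F υs → b₁.Lc → b₂.Lc → Beta S (.case a F υs b₁ b₂) (.capp b₁') R
  | patternFalse {R a F υs b₁ b₂} : Value S .nom a → ¬ AppsPath S .nom a F υs →
      SatApp S F υs → b₁.Lc → b₂.Lc → Beta S (.case a F υs b₁ b₂) b₂ R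

/-! ### Typing -/

/-- `BranchTyping υs a A b T B C`: for a case expression with scrutinee `a : A` and result type
`C`, and a partially applied pattern `b : T` that still awaits arguments with flags `υs`, the
branch for that pattern has type `B`.  The branch abstracts over the remaining arguments of the
pattern and then over a proof that the scrutinee equals the fully applied pattern. -/
inductive BranchTyping : List AnyFlag → Tm → Tm → Tm → Tm → Tm → Tm → Prop where
  | base {a A b C} : BranchTyping [] a A b A (.cpi a b A .nom C) C
  | piRel {ν υs a A b A' T B C} (L : Finset ℕ) : ν.Relevant →
      (∀ x ∉ L, BranchTyping υs a A (.app b ν (.fvar x)) (T.at x) (B.at x) C) →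
      BranchTyping (.tm ν :: υs) a A b (.pi .rel A' T) (.pi .rel A' B) C
  | piIrrel {υs a A b A' T B C} (L : Finset ℕ) :
      (∀ x ∉ L, BranchTyping υs a A (.app b (.rho .irr) .box) (T.at x) (B.at x) C) →
      BranchTyping (.tm (.rho .irr) :: υs) a A b (.pi .irr A' T) (.pi .irr A' B) C
  | cpi {υs a A b a₁ a₂ A' R T B C} :
      BranchTyping υs a A (.capp b) T B C →
      BranchTyping (.co :: υs) a A b (.cpi a₁ a₂ A' R T) (.cpi a₁ a₂ A' R B) C

/-- The variable of an irrelevant abstraction does not occur in its body. -/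
inductive RhoCheck : Relevance → ℕ → Tm → Prop where
  | rel {x a} : RhoCheck .rel x a
  | irrel {x a} : x ∉ a.fv → RhoCheck .irr x a

/-! In the judgments below, `Δ` is the set of coercion variables available to definitional
equality.  Premises on a bound variable are required for all but finitely many names. -/

mutual

/-- `Γ ⊨ φ ok`. -/
inductive PropWff (S : Signature) : Context → Constr → Prop where
  | wff {Γ a b A R} : Typing S Γ a A → Typing S Γ b A → Typing S Γ A .star →
      PropWff S Γ ⟨a, b, A, R⟩

/-- `Γ ⊨ a : A`. -/
inductive Typing (S : Signature) : Context → Tm → Tm → Prop where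
  | star {Γ} : Ctx S Γ → Typing S Γ .star .star
  | var {Γ x A} : Ctx S Γ → (x, .tm A) ∈ Γ → Typing S Γ (.fvar x) A
  | pi {Γ ρ A B} (L : Finset ℕ) :
      (∀ x ∉ L, Typing S ((x, .tm A) :: Γ) (B.at x) .star) → Typing S Γ A .star →
      Typing S Γ (.pi ρ A B) .star
  | abs {Γ ρ a A B} (L : Finset ℕ) :
      (∀ x ∉ L, Typing S ((x, .tm A) :: Γ) (a.at x) (B.at x)) → Typing S Γ A .star →
      (∀ x ∉ L, RhoCheck ρ x (a.at x)) →
      Typing S Γ (.abs ρ a) (.pi ρ A B)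
  | app {Γ b a A B} : Typing S Γ b (.pi .rel A B) → Typing S Γ a A →
      Typing S Γ (.app b (.rho .rel) a) (B.inst a)
  | tapp {Γ b a A B R Rs} : Typing S Γ b (.pi .rel A B) → Typing S Γ a A →
      RolePath S b (R :: Rs) → Typing S Γ (.app b (.role R) a) (B.inst a)
  | iapp {Γ b a A B} : Typing S Γ b (.pi .irr A B) → Typing S Γ a A →
      Typing S Γ (.app b (.rho .irr) .box) (B.inst a)
  | conv {Γ a A B} : Typing S Γ a A → DefEq S Γ Γ.dom A B .star .rep → Typing S Γ B .star →
      Typing S Γ a B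
  | cpi {Γ a b A R B} (L : Finset ℕ) :
      (∀ c ∉ L, Typing S ((c, .co ⟨a, b, A, R⟩) :: Γ) B .star) → PropWff S Γ ⟨a, b, A, R⟩ →
      Typing S Γ (.cpi a b A R B) .star
  | cabs {Γ a b A R a₁ B} (L : Finset ℕ) :
      (∀ c ∉ L, Typing S ((c, .co ⟨a, b, A, R⟩) :: Γ) a₁ B) → PropWff S Γ ⟨a, b, A, R⟩ →
      Typing S Γ (.cabs a₁) (.cpi a b A R B)
  | capp {Γ a₁ B a b A R} : Typing S Γ a₁ (.cpi a b A R B) → DefEq S Γ Γ.dom a b A R →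
      Typing S Γ (.capp a₁) B
  | const {Γ F A Rs} : Ctx S Γ → (F, .const A Rs) ∈ S → Typing S [] A .star →
      Typing S Γ (.fam F) A
  | fam {Γ F p a A R Rs} : Ctx S Γ → (F, .ax p a A R Rs) ∈ S → Typing S [] A .star →
      Typing S Γ (.fam F) A
  | case {Γ a F υs b₁ b₂ A A₁ B C} : Typing S Γ a A → Typing S Γ b₁ B → Typing S Γ b₂ C →
      Typing S Γ (.fam F) A₁ → BranchTyping υs a A (.fam F) A₁ B C → SatApp S F υs →
      Typing S Γ (.case a F υs b₁ b₂) C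

/-- `Γ; Δ ⊨ φ₁ ≡ φ₂`. -/
inductive Iso (S : Signature) : Context → Finset ℕ → Constr → Constr → Prop where
  | propCong {Γ Δ a a' b b' A R} : DefEq S Γ Δ a a' A R → DefEq S Γ Δ b b' A R →
      Iso S Γ Δ ⟨a, b, A, R⟩ ⟨a', b', A, R⟩
  | isoConv {Γ Δ a b A B R} : DefEq S Γ Δ A B .star .rep → PropWff S Γ ⟨a, b, A, R⟩ →
      PropWff S Γ ⟨a, b, B, R⟩ → Iso S Γ Δ ⟨a, b, A, R⟩ ⟨a, b, B, R⟩
  | cpiFst {Γ Δ a b A R B a' b' A' R' B' R₀} :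
      DefEq S Γ Δ (.cpi a b A R B) (.cpi a' b' A' R' B') .star R₀ →
      Iso S Γ Δ ⟨a, b, A, R⟩ ⟨a', b', A', R'⟩

/-- `DefEq S Γ Δ a b A R` is `Γ; Δ ⊨ a ≡_R b : A`. -/
inductive DefEq (S : Signature) : Context → Finset ℕ → Tm → Tm → Tm → Role → Prop where
  | assn {Γ Δ c a b A R} : Ctx S Γ → (c, .co ⟨a, b, A, R⟩) ∈ Γ → c ∈ Δ → DefEq S Γ Δ a b A R
  | refl {Γ Δ a A R} : Typing S Γ a A → DefEq S Γ Δ a a A R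
  | symm {Γ Δ a b A R} : DefEq S Γ Δ b a A R → DefEq S Γ Δ a b A R
  | trans {Γ Δ a a₁ b A R} : DefEq S Γ Δ a a₁ A R → DefEq S Γ Δ a₁ b A R → DefEq S Γ Δ a b A R
  | sub {Γ Δ a b A R₁ R₂} : DefEq S Γ Δ a b A R₁ → SubRole R₁ R₂ → DefEq S Γ Δ a b A R₂
  | beta {Γ Δ a₁ a₂ B R} : Typing S Γ a₁ B → Typing S Γ a₂ B → Beta S a₁ a₂ R →
      DefEq S Γ Δ a₁ a₂ B R
  | piCong {Γ Δ ρ A₁ A₂ B₁ B₂ R} (L : Finset ℕ) : DefEq S Γ Δ A₁ A₂ .star R →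
      (∀ x ∉ L, DefEq S ((x, .tm A₁) :: Γ) Δ (B₁.at x) (B₂.at x) .star R) →
      Typing S Γ A₁ .star → Typing S Γ (.pi ρ A₁ B₁) .star → Typing S Γ (.pi ρ A₂ B₂) .star →
      DefEq S Γ Δ (.pi ρ A₁ B₁) (.pi ρ A₂ B₂) .star R
  | absCong {Γ Δ ρ b₁ b₂ A B R} (L : Finset ℕ) :
      (∀ x ∉ L, DefEq S ((x, .tm A) :: Γ) Δ (b₁.at x) (b₂.at x) (B.at x) R) →
      Typing S Γ A .star →
      (∀ x ∉ L, RhoCheck ρ x (b₁.at x)) → (∀ x ∉ L, RhoCheck ρ x (b₂.at x)) →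
      DefEq S Γ Δ (.abs ρ b₁) (.abs ρ b₂) (.pi ρ A B) R
  | appCong {Γ Δ a₁ b₁ a₂ b₂ A B R} : DefEq S Γ Δ a₁ b₁ (.pi .rel A B) R →
      DefEq S Γ Δ a₂ b₂ A .nom →
      DefEq S Γ Δ (.app a₁ (.rho .rel) a₂) (.app b₁ (.rho .rel) b₂) (B.inst a₂) R
  | tappCong {Γ Δ a₁ b₁ a₂ b₂ A B R R' Rs Rs'} : DefEq S Γ Δ a₁ b₁ (.pi .rel A B) R' →
      DefEq S Γ Δ a₂ b₂ A (R.min R') →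
      RolePath S a₁ (R :: Rs) → RolePath S b₁ (R :: Rs') →
      Typing S Γ (.app b₁ (.role R) b₂) (B.inst a₂) →
      DefEq S Γ Δ (.app a₁ (.role R) a₂) (.app b₁ (.role R) b₂) (B.inst a₂) R'
  | iappCong {Γ Δ a₁ b₁ a A B R} : DefEq S Γ Δ a₁ b₁ (.pi .irr A B) R → Typing S Γ a A →
      DefEq S Γ Δ (.app a₁ (.rho .irr) .box) (.app b₁ (.rho .irr) .box) (B.inst a) R
  | piFst {Γ Δ ρ A₁ A₂ B₁ B₂ R} : DefEq S Γ Δ (.pi ρ A₁ B₁) (.pi ρ A₂ B₂) .star R →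
      DefEq S Γ Δ A₁ A₂ .star R
  | piSnd {Γ Δ ρ A₁ A₂ B₁ B₂ a₁ a₂ R} : DefEq S Γ Δ (.pi ρ A₁ B₁) (.pi ρ A₂ B₂) .star R →
      DefEq S Γ Δ a₁ a₂ A₁ .nom → DefEq S Γ Δ (B₁.inst a₁) (B₂.inst a₂) .star R
  | cpiCong {Γ Δ a b A R B a' b' A' R' B' R₀} (L : Finset ℕ) :
      Iso S Γ Δ ⟨a, b, A, R⟩ ⟨a', b', A', R'⟩ →
      (∀ c ∉ L, DefEq S ((c, .co ⟨a, b, A, R⟩) :: Γ) Δ B B' .star R₀) →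
      PropWff S Γ ⟨a, b, A, R⟩ → Typing S Γ (.cpi a b A R B) .star →
      Typing S Γ (.cpi a' b' A' R' B') .star →
      DefEq S Γ Δ (.cpi a b A R B) (.cpi a' b' A' R' B') .star R₀
  | cabsCong {Γ Δ a b A R a₁ b₁ B R₀} (L : Finset ℕ) :
      (∀ c ∉ L, DefEq S ((c, .co ⟨a, b, A, R⟩) :: Γ) Δ a₁ b₁ B R₀) →
      PropWff S Γ ⟨a, b, A, R⟩ →
      DefEq S Γ Δ (.cabs a₁) (.cabs b₁) (.cpi a b A R B) R₀
  | cappCong {Γ Δ a₁ b₁ a b A R B R'} : DefEq S Γ Δ a₁ b₁ (.cpi a b A R B) R' →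
      DefEq S Γ Γ.dom a b A R → DefEq S Γ Δ (.capp a₁) (.capp b₁) B R'
  | cpiSnd {Γ Δ a₁ a₂ A R B₁ a₁' a₂' A' R' B₂ R₀} :
      DefEq S Γ Δ (.cpi a₁ a₂ A R B₁) (.cpi a₁' a₂' A' R' B₂) .star R₀ →
      DefEq S Γ Γ.dom a₁ a₂ A R → DefEq S Γ Γ.dom a₁' a₂' A' R' →
      DefEq S Γ Δ B₁ B₂ .star R₀
  | cast {Γ Δ a b A R a' b' A' R'} : DefEq S Γ Δ a b A R →
      Iso S Γ Δ ⟨a, b, A, R⟩ ⟨a', b', A', R'⟩ → DefEq S Γ Δ a' b' A' R'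
  | eqConv {Γ Δ a b A B R} : DefEq S Γ Δ a b A R → DefEq S Γ Γ.dom A B .star .rep →
      DefEq S Γ Δ a b B R
  | isoSnd {Γ Δ a b A R a' b' A' R'} : Iso S Γ Δ ⟨a, b, A, R⟩ ⟨a', b', A', R'⟩ →
      DefEq S Γ Δ A A' .star .rep
  | patCong {Γ Δ a a' F υs b₁ b₁' b₂ b₂' A A₁ B B' C R} : DefEq S Γ Δ a a' A .nom →
      DefEq S Γ Δ b₁ b₁' B R → DefEq S Γ Δ b₂ b₂' C R → Typing S Γ (.fam F) A₁ →
      BranchTyping υs a A (.fam F) A₁ B C → BranchTyping υs a' A (.fam F) A₁ B' C →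
      DefEq S Γ Γ.dom B B' .star .rep → SatApp S F υs →
      DefEq S Γ Δ (.case a F υs b₁ b₂) (.case a' F υs b₁' b₂') C R
  | leftRel {Γ Δ F a a' b b' A B R₁ R₂} : CasePath S R₂ (.app a (.role R₁) b) F →
      CasePath S R₂ (.app a' (.role R₁) b') F →
      Typing S Γ a (.pi .rel A B) → Typing S Γ b A →
      Typing S Γ a' (.pi .rel A B) → Typing S Γ b' A →
      DefEq S Γ Δ (.app a (.role R₁) b) (.app a' (.role R₁) b') (B.inst b) R₂ →
      DefEq S Γ Γ.dom (B.inst b) (B.inst b') .star .rep →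
      DefEq S Γ Δ a a' (.pi .rel A B) R₂
  | leftIrrel {Γ Δ F a a' b b' A B R} : CasePath S R (.app a (.rho .irr) .box) F →
      CasePath S R (.app a' (.rho .irr) .box) F →
      Typing S Γ a (.pi .irr A B) → Typing S Γ b A →
      Typing S Γ a' (.pi .irr A B) → Typing S Γ b' A →
      DefEq S Γ Δ (.app a (.rho .irr) .box) (.app a' (.rho .irr) .box) (B.inst b) R →
      DefEq S Γ Γ.dom (B.inst b) (B.inst b') .star .rep →
      DefEq S Γ Δ a a' (.pi .irr A B) R
  | right {Γ Δ F a a' b b' A B R₁ R₂} : CasePath S R₂ (.app a (.role R₁) b) F →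
      CasePath S R₂ (.app a' (.role R₁) b') F →
      Typing S Γ a (.pi .rel A B) → Typing S Γ b A →
      Typing S Γ a' (.pi .rel A B) → Typing S Γ b' A →
      DefEq S Γ Δ (.app a (.role R₁) b) (.app a' (.role R₁) b') (B.inst b) R₂ →
      DefEq S Γ Γ.dom (B.inst b) (B.inst b') .star .rep →
      DefEq S Γ Δ b b' A (R₁.min R₂)
  | cLeft {Γ Δ F a a' a₁ a₂ A R B R'} : CasePath S R' (.capp a) F →
      CasePath S R' (.capp a') F →
      Typing S Γ a (.cpi a₁ a₂ A R B) → Typing S Γ a' (.cpi a₁ a₂ A R B) →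
      DefEq S Γ Γ.dom a₁ a₂ A R →
      DefEq S Γ Δ (.capp a) (.capp a') B R' →
      DefEq S Γ Δ a a' (.cpi a₁ a₂ A R B) R'

/-- `⊨ Γ`. -/
inductive Ctx (S : Signature) : Context → Prop where
  | empty : Ctx S []
  | consTm {Γ x A} : Ctx S Γ → Typing S Γ A .star → x ∉ Γ.dom → Ctx S ((x, .tm A) :: Γ)
  | consCo {Γ c φ} : Ctx S Γ → PropWff S Γ φ → c ∉ Γ.dom → Ctx S ((c, .co φ) :: Γ)

end

/-! ### Role-checking and signatures -/

/-- Role-checking contexts `Ω`; the most recent entry comes first. -/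
abbrev RoleCtx := List (ℕ × Role)

/-- `Ω ⊨ a : R`. -/
inductive Roleing (S : Signature) : RoleCtx → Tm → Role → Prop where
  | star {Ω R} : Roleing S Ω .star R
  | box {Ω R} : Roleing S Ω .box R
  | var {Ω x R R₁} : (x, R) ∈ Ω → SubRole R R₁ → Roleing S Ω (.fvar x) R₁
  | const {Ω F A Rs R} : (F, .const A Rs) ∈ S → Roleing S Ω (.fam F) R
  | fam {Ω F p a A R₁ Rs R} : (F, .ax p a A R₁ Rs) ∈ S → Roleing S Ω (.fam F) R
  | abs {Ω ρ a R} (L : Finset ℕ) : (∀ x ∉ L, Roleing S ((x, .nom) :: Ω) (a.at x) R) →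
      Roleing S Ω (.abs ρ a) R
  | app {Ω a ρ b R} : Roleing S Ω a R → Roleing S Ω b .nom → Roleing S Ω (.app a (.rho ρ) b) R
  | tapp {Ω a b R R₁ Rs} : Roleing S Ω a R → RolePath S a (R₁ :: Rs) →
      Roleing S Ω b (R₁.min R) → Roleing S Ω (.app a (.role R₁) b) R
  | pi {Ω ρ A B R} (L : Finset ℕ) : Roleing S Ω A R →
      (∀ x ∉ L, Roleing S ((x, .nom) :: Ω) (B.at x) R) → Roleing S Ω (.pi ρ A B) R
  | cpi {Ω a b A R₁ B R} : Roleing S Ω a R₁ → Roleing S Ω b R₁ → Roleing S Ω A .rep →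
      Roleing S Ω B R → Roleing S Ω (.cpi a b A R₁ B) R
  | cabs {Ω b R} : Roleing S Ω b R → Roleing S Ω (.cabs b) R
  | capp {Ω a R} : Roleing S Ω a R → Roleing S Ω (.capp a) R
  | case {Ω a F υs b₁ b₂ R} : Roleing S Ω a .nom → Roleing S Ω b₁ R → Roleing S Ω b₂ R →
      Roleing S Ω (.case a F υs b₁ b₂) R

/-- `PatCtx p F A Γ B Ω` is `PatCtx(p, F : A) = Γ; B; Ω`: the pattern `p` headed by `F : A` binds
the variables of `Γ`, has type `B`, and gives its relevant variables the roles in `Ω`, where `+`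
counts as `nom`. -/
inductive PatCtx : Tm → ℕ → Tm → Context → Tm → RoleCtx → Prop where
  | const {F A} : PatCtx (.fam F) F A [] A []
  | piRole {p F A Γ A' B Ω x R} : PatCtx p F A Γ (.pi .rel A' B) Ω → x ∉ Γ.dom →
      PatCtx (.app p (.role R) (.fvar x)) F A ((x, .tm A') :: Γ) (B.at x) ((x, R) :: Ω)
  | piRel {p F A Γ A' B Ω x} : PatCtx p F A Γ (.pi .rel A' B) Ω → x ∉ Γ.dom →
      PatCtx (.app p (.rho .rel) (.fvar x)) F A ((x, .tm A') :: Γ) (B.at x) ((x, .nom) :: Ω)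
  | piIrrel {p F A Γ A' B Ω x} : PatCtx p F A Γ (.pi .irr A' B) Ω → x ∉ Γ.dom →
      PatCtx (.app p (.rho .irr) .box) F A ((x, .tm A') :: Γ) (B.at x) Ω
  | cpi {p F A Γ a b A' R B Ω c} : PatCtx p F A Γ (.cpi a b A' R B) Ω → c ∉ Γ.dom →
      PatCtx (.capp p) F A ((c, .co ⟨a, b, A', R⟩) :: Γ) B Ω

/-- `Sig S₀ S`: every declaration of `S` is well formed with respect to the ambient signature
`S₀`, and no constant is declared twice. -/
inductive Sig (S₀ : Signature) : Signature → Prop where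
  | empty : Sig S₀ []
  | consConst {S F A Rs} : Sig S₀ S → Typing S₀ [] A .star → F ∉ S.map Prod.fst →
      Sig S₀ ((F, .const A Rs) :: S)
  | consAx {S F p a A R Γ B Ω} : Sig S₀ S → Typing S₀ [] A .star → F ∉ S.map Prod.fst →
      PatCtx p F A Γ B Ω → Typing S₀ Γ a B → Roleing S₀ Ω a R →
      Sig S₀ ((F, .ax p a A R (Ω.map Prod.snd).reverse) :: S)

/-- A toplevel signature is well formed if its declarations are well formed with respect to the
signature itself; so each declaration may refer to every declared constant. -/
def Signature.WellFormed (S : Signature) : Prop := Sig S S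

end SystemDR

/-!
The two sides of a definitional equality are typed by induction on its derivation, simultaneously
with the statement that both sides of an equality of propositions are well formed
(`DefEq.regular`, `Iso.regular`).  Three facts carry the induction.

* Typing is regular (`Typing.regular`): if `Γ ⊨ a : A` then `Γ ⊨ A : ⋆`.
* `Π`- and `∀`-types can be inverted (`Typing.pi_inv`, `Typing.cpi_inv`), and their bodies may be
  instantiated by a term of the right type (`Typing.pi_inst`) or by a proposition that holds in
  the context (`Typing.cpi_body`).
* An equality that uses the coercion variables in `Δ` also holds with all variables of the context
  available (`DefEq.dom`).  This is what the conversion rule asks for, and it is used where the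
  rules themselves do not supply the equality of types: in the congruence for applications, whose
  two sides have their natural types at different arguments, and in the second projection from an
  equality of `Π`-types.

Weakening, substitution of terms, discharge of propositions and the change of `Δ` are all instances
of one substitution lemma, `DefEq.subst` with its companions.  It is stated for a parallel
substitution and for a notion of context morphism (`CtxMor`) that quantifies over extensions of
the target context, so that one induction proves them all.  The hypothesis on the signature enters
there only, through the stability of primitive reduction (`Beta.sub`): an axiom can be unfolded
after a substitution just as before it because its right-hand side has no free variables other than
those of its pattern.
-/

namespace SystemDR

/-! ### Syntax and substitution -/

/-- Parallel substitution of terms for the free variables. -/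
def Tm.sub (σ : ℕ → Tm) : Tm → Tm
  | .star => .star
  | .bvar i => .bvar i
  | .fvar x => σ x
  | .fam F => .fam F
  | .abs ρ b => .abs ρ (b.sub σ)
  | .app a ν b => .app (a.sub σ) ν (b.sub σ)
  | .box => .box
  | .pi ρ A B => .pi ρ (A.sub σ) (B.sub σ)
  | .cabs b => .cabs (b.sub σ)
  | .capp a => .capp (a.sub σ)
  | .cpi a b A R B => .cpi (a.sub σ) (b.sub σ) (A.sub σ) R (B.sub σ)
  | .case a F υs b₁ b₂ => .case (a.sub σ) F υs (b₁.sub σ) (b₂.sub σ)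

/-- Parallel substitution in each component of an equality proposition. -/
def Constr.sub (σ : ℕ → Tm) (φ : Constr) : Constr :=
  ⟨φ.lhs.sub σ, φ.rhs.sub σ, φ.ty.sub σ, φ.role⟩

/-- The free variables of an equality proposition. -/
def Constr.fv (φ : Constr) : Finset ℕ := φ.lhs.fv ∪ φ.rhs.fv ∪ φ.ty.fv

theorem Tm.LcAt.mono {a : Tm} : ∀ {k l : ℕ}, k ≤ l → a.LcAt k → a.LcAt l := by
  induction a <;> intro k l hkl h <;> simp only [Tm.LcAt] at h ⊢
  case bvar => omega
  case abs ih => exact ih (by omega) h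
  case app ih₁ ih₂ => exact ⟨ih₁ hkl h.1, ih₂ hkl h.2⟩
  case pi ih₁ ih₂ => exact ⟨ih₁ hkl h.1, ih₂ (by omega) h.2⟩
  case cabs ih => exact ih hkl h
  case capp ih => exact ih hkl h
  case cpi i1 i2 i3 i4 => exact ⟨i1 hkl h.1, i2 hkl h.2.1, i3 hkl h.2.2.1, i4 hkl h.2.2.2⟩
  case case i1 i2 i3 => exact ⟨i1 hkl h.1, i2 hkl h.2.1, i3 hkl h.2.2⟩

theorem Tm.openRec_of_lcAt {a : Tm} {u : Tm} :
    ∀ {k : ℕ}, a.LcAt k → Tm.openRec u k a = a := by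
  induction a <;> intro k h <;> simp only [Tm.LcAt] at h <;> simp only [Tm.openRec]
  case bvar => rw [if_neg (by omega)]
  all_goals simp_all

theorem Tm.LcAt.of_openRec {a : Tm} {u : Tm} :
    ∀ {k : ℕ}, (Tm.openRec u k a).LcAt k → a.LcAt (k + 1) := by
  induction a <;> intro k h <;> simp only [Tm.openRec, Tm.LcAt] at h ⊢
  case bvar i =>
    split_ifs at h
    · omega
    · simp only [Tm.LcAt] at h; omega
  case abs ih => exact ih h
  case app ih₁ ih₂ => exact ⟨ih₁ h.1, ih₂ h.2⟩
  case pi ih₁ ih₂ => exact ⟨ih₁ h.1, ih₂ h.2⟩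
  case cabs ih => exact ih h
  case capp ih => exact ih h
  case cpi i1 i2 i3 i4 => exact ⟨i1 h.1, i2 h.2.1, i3 h.2.2.1, i4 h.2.2.2⟩
  case case i1 i2 i3 => exact ⟨i1 h.1, i2 h.2.1, i3 h.2.2⟩

theorem Tm.fv_subset_openRec {a : Tm} {u : Tm} : ∀ {k : ℕ}, a.fv ⊆ (Tm.openRec u k a).fv := by
  induction a <;> intro k <;> simp only [Tm.openRec, Tm.fv]
  case bvar => exact Finset.empty_subset _
  case abs ih => exact ih
  case cabs ih => exact ih
  case capp ih => exact ih
  case app i1 i2 => exact Finset.union_subset_union i1 i2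
  case pi i1 i2 => exact Finset.union_subset_union i1 i2
  case cpi i1 i2 i3 i4 =>
    exact Finset.union_subset_union
      (Finset.union_subset_union (Finset.union_subset_union i1 i2) i3) i4
  case case i1 i2 i3 =>
    exact Finset.union_subset_union (Finset.union_subset_union i1 i2) i3
  all_goals rfl

theorem Tm.fv_subset_at {a : Tm} {x : ℕ} : a.fv ⊆ (a.at x).fv := Tm.fv_subset_openRec

theorem Tm.LcAt.of_at {a : Tm} {x : ℕ} (h : (a.at x).Lc) : a.LcAt 1 := Tm.LcAt.of_openRec h

theorem Tm.LcAt.sub {σ : ℕ → Tm} (hσ : ∀ x, (σ x).Lc) {a : Tm} :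
    ∀ {k : ℕ}, a.LcAt k → (a.sub σ).LcAt k := by
  induction a <;> intro k h <;> simp only [Tm.sub, Tm.LcAt] at h ⊢
  case fvar x => exact (hσ x).mono (Nat.zero_le k)
  all_goals simp_all

theorem Tm.sub_openRec {σ : ℕ → Tm} (hσ : ∀ x, (σ x).Lc) (u : Tm) {a : Tm} :
    ∀ {k : ℕ}, (Tm.openRec u k a).sub σ = Tm.openRec (u.sub σ) k (a.sub σ) := by
  induction a <;> intro k <;> simp only [Tm.sub, Tm.openRec]
  case fvar x => exact (Tm.openRec_of_lcAt ((hσ x).mono (Nat.zero_le k))).symm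
  case bvar i => split_ifs <;> rfl
  all_goals simp_all

theorem Tm.sub_inst {σ : ℕ → Tm} (hσ : ∀ x, (σ x).Lc) (a u : Tm) :
    (a.inst u).sub σ = (a.sub σ).inst (u.sub σ) := Tm.sub_openRec hσ u

theorem Tm.sub_congr {σ τ : ℕ → Tm} {a : Tm} (h : ∀ x ∈ a.fv, σ x = τ x) :
    a.sub σ = a.sub τ := by
  induction a <;> simp_all [Tm.sub, Tm.fv]

theorem Tm.sub_fvar (a : Tm) : a.sub .fvar = a := by
  induction a <;> simp_all [Tm.sub]

theorem Tm.sub_eq_self {σ : ℕ → Tm} {a : Tm} (h : ∀ x ∈ a.fv, σ x = .fvar x) : a.sub σ = a := by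
  rw [Tm.sub_congr h, Tm.sub_fvar]

theorem Constr.sub_eq_self {σ : ℕ → Tm} {φ : Constr} (h : ∀ x ∈ φ.fv, σ x = .fvar x) :
    φ.sub σ = φ := by
  obtain ⟨a, b, A, R⟩ := φ
  simp only [Constr.fv, Finset.mem_union] at h
  simp only [Constr.sub]
  rw [Tm.sub_eq_self (fun x hx => h x (.inl (.inl hx))),
    Tm.sub_eq_self (fun x hx => h x (.inl (.inr hx))), Tm.sub_eq_self (fun x hx => h x (.inr hx))]

theorem Tm.notMem_fv_sub {σ : ℕ → Tm} {x : ℕ} {a : Tm} (hx : x ∉ a.fv)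
    (h : ∀ y, y ≠ x → x ∉ (σ y).fv) : x ∉ (a.sub σ).fv := by
  induction a <;> simp_all [Tm.sub, Tm.fv]
  case fvar y => exact h y (Ne.symm hx)

/-- Substituting into a simultaneous substitution instance of `b` amounts to substituting into the
terms put for its variables, provided that all free variables of `b` are replaced. -/
theorem Tm.sub_msubst {σ : ℕ → Tm} {τ : List (ℕ × Tm)} {b : Tm}
    (h : ∀ x ∈ b.fv, x ∈ τ.map Prod.fst) :
    (b.msubst τ).sub σ = b.msubst (τ.map fun p => (p.1, p.2.sub σ)) := by
  induction b <;> simp only [Tm.msubst, Tm.sub, Tm.fv] at h ⊢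
  case fvar x =>
    specialize h x (by simp)
    induction τ with
    | nil => simp at h
    | cons p τ ih =>
      obtain ⟨y, t⟩ := p
      simp only [List.map_cons, List.mem_cons, List.lookup_cons] at h ⊢
      by_cases hxy : x = y
      · simp [hxy]
      · rw [beq_false_of_ne hxy]
        exact ih (h.resolve_left hxy)
  all_goals simp_all

/-- The substitution puts locally closed terms for variables, fixes the variables outside the
finite set `L`, and introduces none of them. -/
structure SubstFix (L : Finset ℕ) (σ : ℕ → Tm) : Prop where
  lc : ∀ x, (σ x).Lc
  fix : ∀ x ∉ L, σ x = .fvar x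
  fresh : ∀ x ∉ L, ∀ y, y ≠ x → x ∉ (σ y).fv

theorem SubstFix.fvar : SubstFix ∅ .fvar where
  lc _ := trivial
  fix _ _ := rfl
  fresh _ _ _ h := by simpa [Tm.fv] using h.symm

/-- The substitution of `u` for the single variable `x`. -/
def single (x : ℕ) (u : Tm) : ℕ → Tm := Function.update .fvar x u

theorem single_same (x : ℕ) (u : Tm) : single x u x = u := by simp [single]

theorem single_ne {x y : ℕ} (u : Tm) (h : y ≠ x) : single x u y = .fvar y := by simp [single, h]

theorem SubstFix.single {u : Tm} (hu : u.Lc) (x : ℕ) :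
    SubstFix (insert x u.fv) (single x u) where
  lc y := by
    by_cases h : y = x
    · rw [h, single_same]; exact hu
    · rw [single_ne u h]; trivial
  fix y hy := single_ne u (by simp_all)
  fresh y hy z hz := by
    by_cases h : z = x
    · rw [h, single_same]; simp_all
    · rw [single_ne u h]; simpa [Tm.fv] using hz.symm

theorem SubstFix.sub_at {L : Finset ℕ} {σ : ℕ → Tm} (hσ : SubstFix L σ) {x : ℕ} (hx : x ∉ L)
    (a : Tm) : (a.at x).sub σ = (a.sub σ).at x := by
  rw [Tm.at, Tm.sub_inst hσ.lc, Tm.sub, hσ.fix x hx, Tm.at]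

theorem Tm.sub_single_of_notMem {x : ℕ} {a : Tm} (u : Tm) (hx : x ∉ a.fv) :
    a.sub (single x u) = a :=
  Tm.sub_eq_self fun _ hy => single_ne u fun h => hx (h ▸ hy)

theorem Tm.sub_single_at {x : ℕ} {a u : Tm} (hu : u.Lc) (hx : x ∉ a.fv) :
    (a.at x).sub (single x u) = a.inst u := by
  rw [Tm.at, Tm.sub_inst (SubstFix.single hu x).lc, Tm.sub, single_same,
    Tm.sub_single_of_notMem u hx]

/-! ### Paths, values and reduction under substitution -/

variable {S : Signature} {L : Finset ℕ} {σ : ℕ → Tm}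

theorem RolePath.sub {a : Tm} {Rs : List Role} (h : RolePath S a Rs) :
    RolePath S (a.sub σ) Rs := by
  induction h with
  | absConst h => exact .absConst h
  | const h => exact .const h
  | tapp _ ih => exact .tapp ih
  | app _ ih => exact .app ih
  | iapp _ ih => exact .iapp ih
  | capp _ ih => exact .capp ih

theorem ValuePath.sub (hσ : SubstFix L σ) {a : Tm} {F : ℕ} (h : ValuePath S a F) :
    ValuePath S (a.sub σ) F := by
  induction h with
  | absConst h => exact .absConst h
  | const h => exact .const h
  | app hν hb _ ih => exact .app hν (hb.sub hσ.lc) ih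
  | iapp _ ih => exact .iapp ih
  | capp _ ih => exact .capp ih

/-- The spine of a path is made of constants, applications and boxes, which a substitution leaves
alone; so it creates no new pattern match. -/
theorem ValuePath.tmPatternAgree_of_sub {a p : Tm} {F : ℕ} (h : ValuePath S a F)
    (hp : TmPatternAgree (a.sub σ) p) : TmPatternAgree a p := by
  induction h generalizing p with
  | absConst _ => exact hp
  | const _ => exact hp
  | app hν hb _ ih =>
    generalize hc : Tm.sub σ _ = c at hp
    cases hp <;> simp only [Tm.sub, Tm.app.injEq, reduceCtorEq] at hc
    case app h₁ h₂ h₃ => obtain ⟨rfl, rfl, rfl⟩ := hc; exact .app hν hb (ih h₃)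
    case iapp h => obtain ⟨rfl, rfl, _⟩ := hc; cases hν
  | iapp _ ih =>
    cases hp with
    | app h => cases h
    | iapp h => exact .iapp (ih h)
  | capp _ ih =>
    cases hp with
    | capp h => exact .capp (ih h)

theorem ValuePath.subTmPatternAgree_of_sub {a p : Tm} {F : ℕ} (h : ValuePath S a F)
    (hp : SubTmPatternAgree (a.sub σ) p) : SubTmPatternAgree a p := by
  induction h with
  | absConst _ => exact hp
  | const _ => exact hp
  | app hν hb h ih =>
    cases hp with
    | base hp => exact .base ((ValuePath.app hν hb h).tmPatternAgree_of_sub hp)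
    | app _ hp => exact .app hb (ih hp)
  | iapp h ih =>
    cases hp with
    | base hp => exact .base ((ValuePath.iapp h).tmPatternAgree_of_sub hp)
    | app _ hp => exact .app trivial (ih hp)
  | capp h ih =>
    cases hp with
    | base hp => exact .base ((ValuePath.capp h).tmPatternAgree_of_sub hp)
    | capp hp => exact .capp (ih hp)

theorem ValuePath.appsPath_of_sub {a : Tm} {F G : ℕ} {R : Role} {υs : List AnyFlag}
    (h : ValuePath S a F) (ha : AppsPath S R (a.sub σ) G υs) : AppsPath S R a G υs := by
  induction h generalizing υs with
  | absConst _ => exact ha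
  | const _ => exact ha
  | app hν hb _ ih =>
    generalize hc : Tm.sub σ _ = c at ha
    cases ha <;> simp only [Tm.sub, Tm.app.injEq, reduceCtorEq] at hc
    case app h₁ h₂ h₃ => obtain ⟨rfl, rfl, rfl⟩ := hc; exact .app hν hb (ih h₃)
    case iapp h => obtain ⟨rfl, rfl, _⟩ := hc; cases hν
  | iapp _ ih =>
    cases ha with
    | app h => cases h
    | iapp h => exact .iapp (ih h)
  | capp _ ih =>
    cases ha with
    | capp h => exact .capp (ih h)

theorem CasePath.valuePath {R : Role} {a : Tm} {F : ℕ} (h : CasePath S R a F) :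
    ValuePath S a F := by
  cases h <;> assumption

theorem CasePath.sub (hσ : SubstFix L σ) {R : Role} {a : Tm} {F : ℕ} (h : CasePath S R a F) :
    CasePath S R (a.sub σ) F := by
  cases h with
  | absConst h hF => exact .absConst (h.sub hσ) hF
  | const h hF hR => exact .const (h.sub hσ) hF hR
  | unMatch h hF hp => exact .unMatch (h.sub hσ) hF fun h' => hp (h.subTmPatternAgree_of_sub h')

theorem Value.sub (hσ : SubstFix L σ) {R : Role} {a : Tm} (h : Value S R a) :
    Value S R (a.sub σ) := by
  induction h with
  | star => exact .star
  | pi h => exact .pi (h.sub (a := .pi _ _ _) hσ.lc)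
  | cpi h => exact .cpi (h.sub (a := .cpi _ _ _ _ _) hσ.lc)
  | absRel h => exact .absRel (h.sub (a := .abs _ _) hσ.lc)
  | absIrrel L' _ ih =>
    refine .absIrrel (L' ∪ L) fun x hx => ?_
    rw [Finset.notMem_union] at hx
    rw [← hσ.sub_at hx.2]
    exact ih x hx.1
  | cabs h => exact .cabs (h.sub (a := .cabs _) hσ.lc)
  | path h => exact .path (h.sub hσ)

/-- For an arbitrary term this fails: a variable may become a path.  Variables are not values. -/
theorem Value.appsPath_of_sub {R : Role} {a : Tm} {F : ℕ} {υs : List AnyFlag}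
    (h : Value S R a) (ha : AppsPath S R (a.sub σ) F υs) : AppsPath S R a F υs := by
  cases h with
  | path h => exact h.valuePath.appsPath_of_sub ha
  | _ => cases ha

theorem AppsPath.sub (hσ : SubstFix L σ) {R : Role} {a : Tm} {F : ℕ} {υs : List AnyFlag}
    (h : AppsPath S R a F υs) : AppsPath S R (a.sub σ) F υs := by
  induction h with
  | absConst h => exact .absConst h
  | const h hR => exact .const h hR
  | app hν hb _ ih => exact .app hν (hb.sub hσ.lc) ih
  | iapp _ ih => exact .iapp ih
  | capp _ ih => exact .capp ih

theorem ApplyArgs.sub (hσ : SubstFix L σ) {a b b' : Tm} (h : ApplyArgs a b b') :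
    ApplyArgs (a.sub σ) (b.sub σ) (b'.sub σ) := by
  induction h with
  | const h => exact .const (h.sub hσ.lc)
  | tapp h _ ih => exact .tapp (h.sub hσ.lc) ih
  | app h _ ih => exact .app (h.sub hσ.lc) ih
  | capp _ ih => exact .capp ih

theorem PatMatch.sub (hσ : SubstFix L σ) {a p : Tm} {τ : List (ℕ × Tm)} (h : PatMatch a p τ) :
    PatMatch (a.sub σ) p (τ.map fun q => (q.1, q.2.sub σ)) := by
  induction h with
  | const => exact .const
  | app hν hb _ ih => exact .app hν (hb.sub hσ.lc) ih
  | iapp _ ih => exact .iapp ih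
  | capp _ ih => exact .capp ih

theorem BranchTyping.sub (hσ : SubstFix L σ) {υs : List AnyFlag} {a A b T B C : Tm}
    (h : BranchTyping υs a A b T B C) :
    BranchTyping υs (a.sub σ) (A.sub σ) (b.sub σ) (T.sub σ) (B.sub σ) (C.sub σ) := by
  induction h with
  | base => exact .base
  | piRel L' hν _ ih =>
    refine .piRel (L' ∪ L) hν fun x hx => ?_
    rw [Finset.notMem_union] at hx
    have := ih x hx.1
    rwa [hσ.sub_at hx.2, hσ.sub_at hx.2, Tm.sub, Tm.sub, hσ.fix x hx.2] at this
  | piIrrel L' _ ih =>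
    refine .piIrrel (L' ∪ L) fun x hx => ?_
    rw [Finset.notMem_union] at hx
    have := ih x hx.1
    rwa [hσ.sub_at hx.2, hσ.sub_at hx.2] at this
  | cpi _ ih => exact .cpi ih

theorem RhoCheck.sub (hσ : SubstFix L σ) {ρ : Relevance} {x : ℕ} {a : Tm} (hx : x ∉ L)
    (h : RhoCheck ρ x (a.at x)) : RhoCheck ρ x ((a.sub σ).at x) := by
  rw [← hσ.sub_at hx]
  cases h with
  | rel => exact .rel
  | irrel h => exact .irrel (Tm.notMem_fv_sub h (hσ.fresh x hx))

theorem Tm.fv_subset_of_at {a : Tm} {L' D : Finset ℕ}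
    (h : ∀ x ∉ L', (a.at x).fv ⊆ insert x D) : a.fv ⊆ D := by
  intro y hy
  obtain ⟨x, hx⟩ := Infinite.exists_notMem_finset (insert y L')
  rw [Finset.mem_insert, not_or] at hx
  exact Finset.mem_of_mem_insert_of_ne (h x hx.2 (Tm.fv_subset_at hy)) (Ne.symm hx.1)

theorem Roleing.fv_subset {Ω : RoleCtx} {a : Tm} {R : Role} (h : Roleing S Ω a R) :
    a.fv ⊆ (Ω.map Prod.fst).toFinset := by
  induction h with
  | var h _ =>
    simp only [Tm.fv, Finset.singleton_subset_iff, List.mem_toFinset]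
    exact List.mem_map_of_mem (f := Prod.fst) h
  | abs L' _ ih =>
    rw [Tm.fv]
    refine Tm.fv_subset_of_at (L' := L') fun x hx => ?_
    simpa using ih x hx
  | pi L' _ _ ihA ih =>
    refine Finset.union_subset ihA (Tm.fv_subset_of_at (L' := L') fun x hx => ?_)
    simpa using ih x hx
  | _ => simp_all [Tm.fv, Finset.union_subset_iff]

/-- The variables that matching replaces are exactly those to which the pattern assigns roles;
irrelevant and coercion variables of the pattern context are not among them. -/
theorem PatCtx.map_fst_eq {p A B : Tm} {F : ℕ} {Γ : Context} {Ω : RoleCtx}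
    (h : PatCtx p F A Γ B Ω) {a : Tm} {τ : List (ℕ × Tm)} (hm : PatMatch a p τ) :
    τ.map Prod.fst = Ω.map Prod.fst := by
  induction h generalizing a τ with
  | const => cases hm; rfl
  | piRole _ _ ih => cases hm with | app _ _ hm => simp [ih hm]
  | piRel _ _ ih => cases hm with | app _ _ hm => simp [ih hm]
  | piIrrel _ _ ih => cases hm with | iapp hm => exact ih hm
  | cpi _ _ ih => cases hm with | capp hm => exact ih hm

theorem Sig.exists_patCtx {S' : Signature} (h : Sig S S') {F : ℕ} {p a A : Tm} {R : Role}
    {Rs : List Role} (hF : (F, SigEntry.ax p a A R Rs) ∈ S') :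
    ∃ Γ B Ω, PatCtx p F A Γ B Ω ∧ Roleing S Ω a R := by
  induction h with
  | empty => simp at hF
  | consConst _ _ _ ih =>
    simp only [List.mem_cons, Prod.mk.injEq, reduceCtorEq, and_false, false_or] at hF
    exact ih hF
  | consAx _ _ _ hp _ hr ih =>
    rcases List.mem_cons.1 hF with h | h
    · simp only [Prod.mk.injEq, SigEntry.ax.injEq] at h
      obtain ⟨rfl, rfl, rfl, rfl, rfl, -⟩ := h
      exact ⟨_, _, _, hp, hr⟩
    · exact ih h

/-- Primitive reduction is stable under substitution.  For the unfolding of an axiom this uses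
that the signature is well formed: role-checking confines the free variables of the right-hand
side to those that the pattern binds. -/
theorem Beta.sub (hS : S.WellFormed) (hσ : SubstFix L σ) {a b : Tm} {R : Role}
    (h : Beta S a b R) : Beta S (a.sub σ) (b.sub σ) R := by
  cases h with
  | appAbs hv hb =>
    rw [Tm.sub_inst hσ.lc]
    exact .appAbs (hv.sub hσ) (hb.sub hσ.lc)
  | cappCAbs h => exact .cappCAbs (h.sub hσ.lc)
  | axiomStep hF hm hR =>
    obtain ⟨τ, hm, rfl⟩ := hm
    obtain ⟨Γ, B, Ω, hp, hr⟩ := Sig.exists_patCtx hS hF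
    refine .axiomStep hF ⟨_, hm.sub hσ, Tm.sub_msubst fun x hx => ?_⟩ hR
    rw [hp.map_fst_eq hm]
    exact List.mem_toFinset.1 (hr.fv_subset hx)
  | patternTrue ha hb hs h₁ h₂ =>
    exact .patternTrue (ha.sub hσ) (hb.sub hσ) hs (h₁.sub hσ.lc) (h₂.sub hσ.lc)
  | patternFalse hv ha hs h₁ h₂ =>
    exact .patternFalse (hv.sub hσ) (fun h => ha (hv.appsPath_of_sub h)) hs (h₁.sub hσ.lc)
      (h₂.sub hσ.lc)

/-! ### Scoping -/

theorem Context.dom_cons (x : ℕ) (b : Binding) (Γ : Context) :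
    Context.dom ((x, b) :: Γ) = insert x (Context.dom Γ) := by
  simp [Context.dom]

theorem Context.mem_dom {Γ : Context} {x : ℕ} {b : Binding} (h : (x, b) ∈ Γ) : x ∈ Γ.dom := by
  rw [Context.dom, List.mem_toFinset]
  exact List.mem_map_of_mem (f := Prod.fst) h

mutual

theorem PropWff.scoped {Γ : Context} {φ : Constr} (h : PropWff S Γ φ) :
    Ctx S Γ ∧ φ.lhs.Lc ∧ φ.rhs.Lc ∧ φ.ty.Lc ∧ φ.fv ⊆ Γ.dom := by
  match h with
  | .wff ha hb hA =>
    exact ⟨ha.scoped.1, ha.scoped.2.1, hb.scoped.2.1, hA.scoped.2.1,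
      Finset.union_subset (Finset.union_subset ha.scoped.2.2 hb.scoped.2.2) hA.scoped.2.2⟩

/-- A typing judgment presupposes its context, and its subject is locally closed with all free
variables declared. -/
theorem Typing.scoped {Γ : Context} {a A : Tm} (h : Typing S Γ a A) :
    Ctx S Γ ∧ a.Lc ∧ a.fv ⊆ Γ.dom := by
  match h with
  | .star h => exact ⟨h, trivial, Finset.empty_subset _⟩
  | .var h hx => exact ⟨h, trivial, Finset.singleton_subset_iff.2 (Context.mem_dom hx)⟩
  | .pi L hB hA =>
    obtain ⟨x, hx⟩ := Infinite.exists_notMem_finset L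
    refine ⟨hA.scoped.1, ⟨hA.scoped.2.1, .of_at (hB x hx).scoped.2.1⟩,
      Finset.union_subset hA.scoped.2.2 (Tm.fv_subset_of_at (L' := L) fun x hx => ?_)⟩
    rw [← Context.dom_cons]
    exact (hB x hx).scoped.2.2
  | .abs L hb hA _ =>
    obtain ⟨x, hx⟩ := Infinite.exists_notMem_finset L
    refine ⟨hA.scoped.1, Tm.LcAt.of_at (hb x hx).scoped.2.1, ?_⟩
    rw [Tm.fv]
    refine Tm.fv_subset_of_at (L' := L) fun x hx => ?_
    rw [← Context.dom_cons]
    exact (hb x hx).scoped.2.2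
  | .app hb ha =>
    exact ⟨hb.scoped.1, ⟨hb.scoped.2.1, ha.scoped.2.1⟩,
      Finset.union_subset hb.scoped.2.2 ha.scoped.2.2⟩
  | .tapp hb ha _ =>
    exact ⟨hb.scoped.1, ⟨hb.scoped.2.1, ha.scoped.2.1⟩,
      Finset.union_subset hb.scoped.2.2 ha.scoped.2.2⟩
  | .iapp hb ha =>
    exact ⟨hb.scoped.1, ⟨hb.scoped.2.1, trivial⟩,
      Finset.union_subset hb.scoped.2.2 (Finset.empty_subset _)⟩
  | .conv ha _ _ => exact ha.scoped
  | .cpi L hB hφ =>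
    obtain ⟨c, hc⟩ := Infinite.exists_notMem_finset L
    obtain ⟨h₁, h₂, h₃, h₄, h₅⟩ := hφ.scoped
    refine ⟨h₁, ⟨h₂, h₃, h₄, (hB c hc).scoped.2.1⟩,
      Finset.union_subset h₅ (Tm.fv_subset_of_at (L' := L) fun c hc => ?_)⟩
    -- A coercion binder carries no index: the body is locally closed, and naming it is vacuous.
    rw [← Context.dom_cons, Tm.at, Tm.inst, Tm.openRec_of_lcAt (hB c hc).scoped.2.1]
    exact (hB c hc).scoped.2.2
  | .cabs L hb hφ =>
    obtain ⟨c, hc⟩ := Infinite.exists_notMem_finset L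
    refine ⟨hφ.scoped.1, (hb c hc).scoped.2.1, ?_⟩
    rw [Tm.fv]
    refine Tm.fv_subset_of_at (L' := L) fun c hc => ?_
    rw [← Context.dom_cons, Tm.at, Tm.inst, Tm.openRec_of_lcAt (hb c hc).scoped.2.1]
    exact (hb c hc).scoped.2.2
  | .capp ha _ => exact ⟨ha.scoped.1, ha.scoped.2.1, ha.scoped.2.2⟩
  | .const h _ _ => exact ⟨h, trivial, Finset.empty_subset _⟩
  | .fam h _ _ => exact ⟨h, trivial, Finset.empty_subset _⟩
  | .case ha hb₁ hb₂ _ _ _ =>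
    exact ⟨ha.scoped.1, ⟨ha.scoped.2.1, hb₁.scoped.2.1, hb₂.scoped.2.1⟩,
      Finset.union_subset (Finset.union_subset ha.scoped.2.2 hb₁.scoped.2.2) hb₂.scoped.2.2⟩

end

theorem Typing.ctx {Γ : Context} {a A : Tm} (h : Typing S Γ a A) : Ctx S Γ := h.scoped.1

theorem Typing.lc {Γ : Context} {a A : Tm} (h : Typing S Γ a A) : a.Lc := h.scoped.2.1

theorem Typing.sub_eq_self_of_nil {a A : Tm} (h : Typing S [] a A) : a.sub σ = a :=
  Tm.sub_eq_self fun x hx => absurd (h.scoped.2.2 hx) (by simp [Context.dom])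

/-! ### Substitution and weakening for the judgments -/

/-- `Γ'` validates the hypotheses of `Γ` under `σ`.  The requirement is imposed in all well-formed
extensions `Γ''` of `Γ'`, so that it survives the passage under a binder without appeal to a
weakening lemma; for the same reason the set `Δ` of available coercion variables may be any that
contains those of `Γ'`. -/
structure CtxMor (S : Signature) (σ : ℕ → Tm) (Γ Γ' : Context) : Prop where
  tm : ∀ Γ'', Γ' ⊆ Γ'' → Ctx S Γ'' → ∀ x A, (x, Binding.tm A) ∈ Γ →
    Typing S Γ'' (σ x) (A.sub σ)
  co : ∀ Γ'', Γ' ⊆ Γ'' → Ctx S Γ'' → ∀ Δ, Γ'.dom ⊆ Δ → ∀ c a b A R,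
    (c, Binding.co ⟨a, b, A, R⟩) ∈ Γ → DefEq S Γ'' Δ (a.sub σ) (b.sub σ) (A.sub σ) R

/-- The propositions of `Γ` that `Δ` makes available hold in `Γ'` under `σ`, with the coercion
variables in `Δ'` available. -/
def AvailMor (S : Signature) (σ : ℕ → Tm) (Γ : Context) (Δ : Finset ℕ) (Γ' : Context)
    (Δ' : Finset ℕ) : Prop :=
  ∀ Γ'', Γ' ⊆ Γ'' → Ctx S Γ'' → ∀ c a b A R, (c, Binding.co ⟨a, b, A, R⟩) ∈ Γ → c ∈ Δ →
    DefEq S Γ'' Δ' (a.sub σ) (b.sub σ) (A.sub σ) R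

theorem CtxMor.avail {Γ Γ' : Context} (h : CtxMor S σ Γ Γ') :
    AvailMor S σ Γ Γ.dom Γ' Γ'.dom :=
  fun Γ'' hΓ hc c a b A R hm _ => h.co Γ'' hΓ hc _ (Finset.Subset.refl _) c a b A R hm

theorem CtxMor.consTm {Γ Γ' : Context} (h : CtxMor S σ Γ Γ') {x : ℕ} (hx : σ x = .fvar x)
    (A : Tm) : CtxMor S σ ((x, .tm A) :: Γ) ((x, .tm (A.sub σ)) :: Γ') where
  tm Γ'' hΓ hc y B hy := by
    rcases List.mem_cons.1 hy with hy | hy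
    · simp only [Prod.mk.injEq, Binding.tm.injEq] at hy
      obtain ⟨rfl, rfl⟩ := hy
      rw [hx]
      exact .var hc (hΓ List.mem_cons_self)
    · exact h.tm Γ'' (List.Subset.trans (List.subset_cons_self _ _) hΓ) hc y B hy
  co Γ'' hΓ hc Δ hΔ c a b B R hm := by
    rw [Context.dom_cons] at hΔ
    exact h.co Γ'' (List.Subset.trans (List.subset_cons_self _ _) hΓ) hc Δ
      (Finset.Subset.trans (Finset.subset_insert _ _) hΔ) c a b B R (by simpa using hm)

theorem CtxMor.consCo {Γ Γ' : Context} (h : CtxMor S σ Γ Γ') (c : ℕ) (φ : Constr) :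
    CtxMor S σ ((c, .co φ) :: Γ) ((c, .co (φ.sub σ)) :: Γ') where
  tm Γ'' hΓ hc y B hy :=
    h.tm Γ'' (List.Subset.trans (List.subset_cons_self _ _) hΓ) hc y B (by simpa using hy)
  co Γ'' hΓ hc Δ hΔ d a b B R hm := by
    rw [Context.dom_cons] at hΔ
    rcases List.mem_cons.1 hm with hm | hm
    · simp only [Prod.mk.injEq, Binding.co.injEq] at hm
      obtain ⟨rfl, rfl⟩ := hm
      exact .assn hc (hΓ List.mem_cons_self) (hΔ (Finset.mem_insert_self _ _))
    · exact h.co Γ'' (List.Subset.trans (List.subset_cons_self _ _) hΓ) hc Δ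
        (Finset.Subset.trans (Finset.subset_insert _ _) hΔ) d a b B R hm

theorem AvailMor.consTm {Γ Γ' : Context} {Δ Δ' : Finset ℕ} (h : AvailMor S σ Γ Δ Γ' Δ') (x : ℕ)
    (A B : Tm) : AvailMor S σ ((x, .tm A) :: Γ) Δ ((x, .tm B) :: Γ') Δ' :=
  fun Γ'' hΓ hc c a b A R hm =>
    h Γ'' (List.Subset.trans (List.subset_cons_self _ _) hΓ) hc c a b A R (by simpa using hm)

theorem AvailMor.consCo {Γ Γ' : Context} {Δ Δ' : Finset ℕ} (h : AvailMor S σ Γ Δ Γ' Δ') {c : ℕ}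
    (hc : c ∉ Δ) (φ ψ : Constr) : AvailMor S σ ((c, .co φ) :: Γ) Δ ((c, .co ψ) :: Γ') Δ' := by
  intro Γ'' hΓ hΓ'' d a b A R hm hd
  rcases List.mem_cons.1 hm with hm | hm
  · simp only [Prod.mk.injEq] at hm
    exact absurd (hm.1 ▸ hd) hc
  · exact h Γ'' (List.Subset.trans (List.subset_cons_self _ _) hΓ) hΓ'' d a b A R hm hd

mutual

theorem PropWff.subst (hS : S.WellFormed) (hσ : SubstFix L σ) {Γ Γ' : Context} {φ : Constr}
    (h : PropWff S Γ φ) (hΓ : Ctx S Γ') (hm : CtxMor S σ Γ Γ') : PropWff S Γ' (φ.sub σ) := by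
  match h with
  | .wff ha hb hA =>
    exact .wff (ha.subst hS hσ hΓ hm) (hb.subst hS hσ hΓ hm) (hA.subst hS hσ hΓ hm)
termination_by structural h

theorem Typing.subst (hS : S.WellFormed) (hσ : SubstFix L σ) {Γ Γ' : Context} {a A : Tm}
    (h : Typing S Γ a A) (hΓ : Ctx S Γ') (hm : CtxMor S σ Γ Γ') :
    Typing S Γ' (a.sub σ) (A.sub σ) := by
  match h with
  | .star _ => exact .star hΓ
  | .var _ hx => exact hm.tm Γ' (List.Subset.refl _) hΓ _ _ hx
  | .pi L' hB hA =>
    have hA' := hA.subst hS hσ hΓ hm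
    refine .pi (L' ∪ L ∪ Γ'.dom) (fun x hx => ?_) hA'
    simp only [Finset.notMem_union] at hx
    rw [← hσ.sub_at hx.1.2]
    exact (hB x hx.1.1).subst hS hσ (.consTm hΓ hA' hx.2) (hm.consTm (hσ.fix x hx.1.2) _)
  | .abs L' hb hA hρ =>
    have hA' := hA.subst hS hσ hΓ hm
    refine .abs (L' ∪ L ∪ Γ'.dom) (fun x hx => ?_) hA' (fun x hx => ?_) <;>
      simp only [Finset.notMem_union] at hx
    · rw [← hσ.sub_at hx.1.2, ← hσ.sub_at hx.1.2]
      exact (hb x hx.1.1).subst hS hσ (.consTm hΓ hA' hx.2) (hm.consTm (hσ.fix x hx.1.2) _)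
    · exact (hρ x hx.1.1).sub hσ hx.1.2
  | .app hb ha =>
    rw [Tm.sub_inst hσ.lc]
    exact .app (hb.subst hS hσ hΓ hm) (ha.subst hS hσ hΓ hm)
  | .tapp hb ha hR =>
    rw [Tm.sub_inst hσ.lc]
    exact .tapp (hb.subst hS hσ hΓ hm) (ha.subst hS hσ hΓ hm) hR.sub
  | .iapp hb ha =>
    rw [Tm.sub_inst hσ.lc]
    exact .iapp (hb.subst hS hσ hΓ hm) (ha.subst hS hσ hΓ hm)
  | .conv ha hAB hB =>
    exact .conv (ha.subst hS hσ hΓ hm) (hAB.subst hS hσ hΓ hm hm.avail) (hB.subst hS hσ hΓ hm)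
  | .cpi L' hB hφ =>
    have hφ' := hφ.subst hS hσ hΓ hm
    refine .cpi (L' ∪ Γ'.dom) (fun c hc => ?_) hφ'
    simp only [Finset.notMem_union] at hc
    exact (hB c hc.1).subst hS hσ (.consCo hΓ hφ' hc.2) (hm.consCo c _)
  | .cabs L' hb hφ =>
    have hφ' := hφ.subst hS hσ hΓ hm
    refine .cabs (L' ∪ Γ'.dom) (fun c hc => ?_) hφ'
    simp only [Finset.notMem_union] at hc
    exact (hb c hc.1).subst hS hσ (.consCo hΓ hφ' hc.2) (hm.consCo c _)
  | .capp ha hab => exact .capp (ha.subst hS hσ hΓ hm) (hab.subst hS hσ hΓ hm hm.avail)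
  | .const _ hF hA =>
    rw [hA.sub_eq_self_of_nil]
    exact .const hΓ hF hA
  | .fam _ hF hA =>
    rw [hA.sub_eq_self_of_nil]
    exact .fam hΓ hF hA
  | .case ha hb₁ hb₂ hF hbr hs =>
    exact .case (ha.subst hS hσ hΓ hm) (hb₁.subst hS hσ hΓ hm) (hb₂.subst hS hσ hΓ hm)
      (hF.subst hS hσ hΓ hm) (hbr.sub hσ) hs
termination_by structural h

theorem Iso.subst (hS : S.WellFormed) (hσ : SubstFix L σ) {Γ Γ' : Context} {Δ Δ' : Finset ℕ}
    {φ₁ φ₂ : Constr} (h : Iso S Γ Δ φ₁ φ₂) (hΓ : Ctx S Γ') (hm : CtxMor S σ Γ Γ')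
    (hd : AvailMor S σ Γ Δ Γ' Δ') : Iso S Γ' Δ' (φ₁.sub σ) (φ₂.sub σ) := by
  match h with
  | .propCong ha hb => exact .propCong (ha.subst hS hσ hΓ hm hd) (hb.subst hS hσ hΓ hm hd)
  | .isoConv hAB h₁ h₂ =>
    exact .isoConv (hAB.subst hS hσ hΓ hm hd) (h₁.subst hS hσ hΓ hm) (h₂.subst hS hσ hΓ hm)
  | .cpiFst h => exact .cpiFst (h.subst hS hσ hΓ hm hd)
termination_by structural h

/-- All judgments are stable under substitution.  The substitution may be the identity, so
weakening is a special case, and the set of available coercion variables may shrink to those that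
the context declares. -/
theorem DefEq.subst (hS : S.WellFormed) (hσ : SubstFix L σ) {Γ Γ' : Context} {Δ Δ' : Finset ℕ}
    {a b A : Tm} {R : Role} (h : DefEq S Γ Δ a b A R) (hΓ : Ctx S Γ') (hm : CtxMor S σ Γ Γ')
    (hd : AvailMor S σ Γ Δ Γ' Δ') : DefEq S Γ' Δ' (a.sub σ) (b.sub σ) (A.sub σ) R := by
  match h with
  | .assn _ hc hcΔ => exact hd Γ' (List.Subset.refl _) hΓ _ _ _ _ _ hc hcΔ
  | .refl h => exact .refl (h.subst hS hσ hΓ hm)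
  | .symm h => exact .symm (h.subst hS hσ hΓ hm hd)
  | .trans h₁ h₂ => exact .trans (h₁.subst hS hσ hΓ hm hd) (h₂.subst hS hσ hΓ hm hd)
  | .sub h hR => exact .sub (h.subst hS hσ hΓ hm hd) hR
  | .beta h₁ h₂ hβ => exact .beta (h₁.subst hS hσ hΓ hm) (h₂.subst hS hσ hΓ hm) (hβ.sub hS hσ)
  | .piCong L' hA hB hA₁ h₁ h₂ =>
    have hA' := hA₁.subst hS hσ hΓ hm
    refine .piCong (L' ∪ L ∪ Γ'.dom) (hA.subst hS hσ hΓ hm hd) (fun x hx => ?_) hA'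
      (h₁.subst hS hσ hΓ hm) (h₂.subst hS hσ hΓ hm)
    simp only [Finset.notMem_union] at hx
    rw [← hσ.sub_at hx.1.2, ← hσ.sub_at hx.1.2]
    exact (hB x hx.1.1).subst hS hσ (.consTm hΓ hA' hx.2) (hm.consTm (hσ.fix x hx.1.2) _)
      (hd.consTm x _ _)
  | .absCong L' hb hA h₁ h₂ =>
    have hA' := hA.subst hS hσ hΓ hm
    refine .absCong (L' ∪ L ∪ Γ'.dom) (fun x hx => ?_) hA' (fun x hx => ?_) (fun x hx => ?_) <;>
      simp only [Finset.notMem_union] at hx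
    · rw [← hσ.sub_at hx.1.2, ← hσ.sub_at hx.1.2, ← hσ.sub_at hx.1.2]
      exact (hb x hx.1.1).subst hS hσ (.consTm hΓ hA' hx.2) (hm.consTm (hσ.fix x hx.1.2) _)
        (hd.consTm x _ _)
    · exact (h₁ x hx.1.1).sub hσ hx.1.2
    · exact (h₂ x hx.1.1).sub hσ hx.1.2
  | .appCong h₁ h₂ =>
    rw [Tm.sub_inst hσ.lc]
    exact .appCong (h₁.subst hS hσ hΓ hm hd) (h₂.subst hS hσ hΓ hm hd)
  | .tappCong h₁ h₂ hR hR' h =>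
    have h' := h.subst hS hσ hΓ hm
    rw [Tm.sub_inst hσ.lc] at h' ⊢
    exact .tappCong (h₁.subst hS hσ hΓ hm hd) (h₂.subst hS hσ hΓ hm hd) hR.sub hR'.sub h'
  | .iappCong h₁ h =>
    rw [Tm.sub_inst hσ.lc]
    exact .iappCong (h₁.subst hS hσ hΓ hm hd) (h.subst hS hσ hΓ hm)
  | .piFst h => exact .piFst (h.subst hS hσ hΓ hm hd)
  | .piSnd h₁ h₂ =>
    rw [Tm.sub_inst hσ.lc, Tm.sub_inst hσ.lc]
    exact .piSnd (h₁.subst hS hσ hΓ hm hd) (h₂.subst hS hσ hΓ hm hd)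
  | .cpiCong L' hφ hB hwf h₁ h₂ =>
    have hwf' := hwf.subst hS hσ hΓ hm
    -- Names in `Δ` are avoided because the bound coercion variable must stay unavailable.
    refine .cpiCong (L' ∪ Δ ∪ Γ'.dom) (hφ.subst hS hσ hΓ hm hd) (fun c hc => ?_) hwf'
      (h₁.subst hS hσ hΓ hm) (h₂.subst hS hσ hΓ hm)
    simp only [Finset.notMem_union] at hc
    exact (hB c hc.1.1).subst hS hσ (.consCo hΓ hwf' hc.2) (hm.consCo c _) (hd.consCo hc.1.2 _ _)
  | .cabsCong L' hb hwf =>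
    have hwf' := hwf.subst hS hσ hΓ hm
    refine .cabsCong (L' ∪ Δ ∪ Γ'.dom) (fun c hc => ?_) hwf'
    simp only [Finset.notMem_union] at hc
    exact (hb c hc.1.1).subst hS hσ (.consCo hΓ hwf' hc.2) (hm.consCo c _) (hd.consCo hc.1.2 _ _)
  | .cappCong h₁ h₂ =>
    exact .cappCong (h₁.subst hS hσ hΓ hm hd) (h₂.subst hS hσ hΓ hm hm.avail)
  | .cpiSnd h h₁ h₂ =>
    exact .cpiSnd (h.subst hS hσ hΓ hm hd) (h₁.subst hS hσ hΓ hm hm.avail)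
      (h₂.subst hS hσ hΓ hm hm.avail)
  | .cast h hφ => exact .cast (h.subst hS hσ hΓ hm hd) (hφ.subst hS hσ hΓ hm hd)
  | .eqConv h hAB => exact .eqConv (h.subst hS hσ hΓ hm hd) (hAB.subst hS hσ hΓ hm hm.avail)
  | .isoSnd h => exact .isoSnd (h.subst hS hσ hΓ hm hd)
  | .patCong h h₁ h₂ hF hbr hbr' hB hs =>
    exact .patCong (h.subst hS hσ hΓ hm hd) (h₁.subst hS hσ hΓ hm hd) (h₂.subst hS hσ hΓ hm hd)
      (hF.subst hS hσ hΓ hm) (hbr.sub hσ) (hbr'.sub hσ) (hB.subst hS hσ hΓ hm hm.avail) hs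
  | .leftRel hp hp' ha hb ha' hb' h hB =>
    have h' := h.subst hS hσ hΓ hm hd
    have hB' := hB.subst hS hσ hΓ hm hm.avail
    rw [Tm.sub_inst hσ.lc] at h' hB'
    rw [Tm.sub_inst hσ.lc] at hB'
    exact .leftRel (hp.sub hσ) (hp'.sub hσ) (ha.subst hS hσ hΓ hm) (hb.subst hS hσ hΓ hm)
      (ha'.subst hS hσ hΓ hm) (hb'.subst hS hσ hΓ hm) h' hB'
  | .leftIrrel hp hp' ha hb ha' hb' h hB =>
    have h' := h.subst hS hσ hΓ hm hd
    have hB' := hB.subst hS hσ hΓ hm hm.avail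
    rw [Tm.sub_inst hσ.lc] at h' hB'
    rw [Tm.sub_inst hσ.lc] at hB'
    exact .leftIrrel (hp.sub hσ) (hp'.sub hσ) (ha.subst hS hσ hΓ hm) (hb.subst hS hσ hΓ hm)
      (ha'.subst hS hσ hΓ hm) (hb'.subst hS hσ hΓ hm) h' hB'
  | .right hp hp' ha hb ha' hb' h hB =>
    have h' := h.subst hS hσ hΓ hm hd
    have hB' := hB.subst hS hσ hΓ hm hm.avail
    rw [Tm.sub_inst hσ.lc] at h' hB'
    rw [Tm.sub_inst hσ.lc] at hB'
    exact .right (hp.sub hσ) (hp'.sub hσ) (ha.subst hS hσ hΓ hm) (hb.subst hS hσ hΓ hm)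
      (ha'.subst hS hσ hΓ hm) (hb'.subst hS hσ hΓ hm) h' hB'
  | .cLeft hp hp' ha ha' h₁ h =>
    exact .cLeft (hp.sub hσ) (hp'.sub hσ) (ha.subst hS hσ hΓ hm) (ha'.subst hS hσ hΓ hm)
      (h₁.subst hS hσ hΓ hm hm.avail) (h.subst hS hσ hΓ hm hd)
termination_by structural h

end

theorem CtxMor.of_subset {Γ Γ' : Context} (h : Γ ⊆ Γ') : CtxMor S .fvar Γ Γ' where
  tm Γ'' hΓ hc x A hx := by
    rw [Tm.sub_fvar]
    exact .var hc (hΓ (h hx))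
  co Γ'' hΓ hc Δ hΔ c a b A R hm := by
    simp only [Tm.sub_fvar]
    exact .assn hc (hΓ (h hm)) (hΔ (Context.mem_dom (h hm)))

theorem Typing.weaken (hS : S.WellFormed) {Γ Γ' : Context} {a A : Tm} (h : Typing S Γ a A)
    (hΓ : Ctx S Γ') (hsub : Γ ⊆ Γ') : Typing S Γ' a A := by
  simpa only [Tm.sub_fvar] using h.subst hS .fvar hΓ (.of_subset hsub)

theorem PropWff.weaken (hS : S.WellFormed) {Γ Γ' : Context} {φ : Constr} (h : PropWff S Γ φ)
    (hΓ : Ctx S Γ') (hsub : Γ ⊆ Γ') : PropWff S Γ' φ := by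
  simpa only [Constr.sub, Tm.sub_fvar] using h.subst hS .fvar hΓ (.of_subset hsub)

theorem DefEq.weaken (hS : S.WellFormed) {Γ Γ' : Context} {Δ Δ' : Finset ℕ} {a b A : Tm}
    {R : Role} (h : DefEq S Γ Δ a b A R) (hΓ : Ctx S Γ') (hsub : Γ ⊆ Γ')
    (hΔ : Δ ∩ Γ.dom ⊆ Δ') : DefEq S Γ' Δ' a b A R := by
  have hd : AvailMor S .fvar Γ Δ Γ' Δ' := fun Γ'' hΓ' hc c a b A R hm hcΔ => by
    simp only [Tm.sub_fvar]
    exact .assn hc (hΓ' (hsub hm)) (hΔ (Finset.mem_inter.2 ⟨hcΔ, Context.mem_dom hm⟩))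
  simpa only [Tm.sub_fvar] using h.subst hS .fvar hΓ (.of_subset hsub) hd

/-- Only the coercion variables that the context declares matter, so every equality also holds
with all of them available. -/
theorem DefEq.dom (hS : S.WellFormed) {Γ : Context} {Δ : Finset ℕ} {a b A : Tm}
    {R : Role} (h : DefEq S Γ Δ a b A R) (hΓ : Ctx S Γ) : DefEq S Γ Γ.dom a b A R :=
  h.weaken hS hΓ (List.Subset.refl _) Finset.inter_subset_right

/-- The free variables of the types and propositions in a context. -/
def Context.fv : Context → Finset ℕ
  | [] => ∅
  | (_, .tm A) :: Γ => A.fv ∪ Context.fv Γ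
  | (_, .co φ) :: Γ => φ.fv ∪ Context.fv Γ

theorem Context.fv_tm {Γ : Context} {x : ℕ} {A : Tm} (h : (x, Binding.tm A) ∈ Γ) :
    A.fv ⊆ Γ.fv := by
  induction Γ with
  | nil => simp at h
  | cons p Γ ih =>
    rcases List.mem_cons.1 h with rfl | h'
    · exact Finset.subset_union_left
    · obtain ⟨y, B | φ⟩ := p <;> exact (ih h').trans Finset.subset_union_right

theorem Context.fv_co {Γ : Context} {c : ℕ} {φ : Constr} (h : (c, Binding.co φ) ∈ Γ) :
    φ.fv ⊆ Γ.fv := by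
  induction Γ with
  | nil => simp at h
  | cons p Γ ih =>
    rcases List.mem_cons.1 h with rfl | h'
    · exact Finset.subset_union_left
    · obtain ⟨y, B | φ⟩ := p <;> exact (ih h').trans Finset.subset_union_right

/-- Instantiating the most recent variable, provided that it is fresh for the rest. -/
theorem CtxMor.single (hS : S.WellFormed) {Γ : Context} {x : ℕ} {u A : Tm}
    (hu : Typing S Γ u A) (hxA : x ∉ A.fv) (hx : x ∉ Γ.fv) (hxd : x ∉ Γ.dom) :
    CtxMor S (single x u) ((x, .tm A) :: Γ) Γ where
  tm Γ'' hΓ hc y B hy := by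
    rcases List.mem_cons.1 hy with hy | hy
    · simp only [Prod.mk.injEq, Binding.tm.injEq] at hy
      obtain ⟨rfl, rfl⟩ := hy
      rw [single_same, Tm.sub_single_of_notMem u hxA]
      exact hu.weaken hS hc hΓ
    · have hyx : y ≠ x := fun h => hxd (h ▸ Context.mem_dom hy)
      rw [single_ne u hyx, Tm.sub_single_of_notMem u fun h => hx (Context.fv_tm hy h)]
      exact .var hc (hΓ hy)
  co Γ'' hΓ hc Δ hΔ c a b B R hm := by
    have hm' : (c, Binding.co ⟨a, b, B, R⟩) ∈ Γ := by simpa using hm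
    have h := Constr.sub_eq_self (σ := SystemDR.single x u) (φ := ⟨a, b, B, R⟩)
      fun z hz => single_ne u fun h => hx (h ▸ Context.fv_co hm' hz)
    simp only [Constr.sub, Constr.mk.injEq] at h
    rw [h.1, h.2.1, h.2.2.1]
    exact .assn hc (hΓ hm') (hΔ (Context.mem_dom hm'))

/-- Instantiating a cofinitely typed body. -/
theorem Typing.inst (hS : S.WellFormed) {Γ : Context} {A B T u : Tm}
    (hB : ∀ x ∉ L, Typing S ((x, .tm A) :: Γ) (B.at x) (T.at x)) (hu : Typing S Γ u A) :
    Typing S Γ (B.inst u) (T.inst u) := by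
  obtain ⟨x, hx⟩ := Infinite.exists_notMem_finset
    (L ∪ A.fv ∪ B.fv ∪ T.fv ∪ Γ.fv ∪ Γ.dom)
  simp only [Finset.notMem_union] at hx
  obtain ⟨⟨⟨⟨⟨hL, hA⟩, hxB⟩, hxT⟩, hΓ⟩, hd⟩ := hx
  have h := (hB x hL).subst hS (.single hu.lc x) hu.ctx (.single hS hu hA hΓ hd)
  rwa [Tm.sub_single_at hu.lc hxB, Tm.sub_single_at hu.lc hxT] at h

/-- A proposition that holds in the context may be discharged from a typing derivation. -/
theorem Typing.discharge (hS : S.WellFormed) {Γ : Context} {c : ℕ} {a b A B T : Tm} {R : Role}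
    (h : Typing S ((c, .co ⟨a, b, A, R⟩) :: Γ) B T) (hΓ : Ctx S Γ)
    (hab : DefEq S Γ Γ.dom a b A R) : Typing S Γ B T := by
  have hm : CtxMor S .fvar ((c, .co ⟨a, b, A, R⟩) :: Γ) Γ :=
    { tm := fun Γ'' hΓ' hc x A hx => by
        rw [Tm.sub_fvar]
        exact .var hc (hΓ' (by simpa using hx))
      co := fun Γ'' hΓ' hc Δ hΔ d a' b' A' R' hm => by
        simp only [Tm.sub_fvar]
        rcases List.mem_cons.1 hm with hm | hm
        · simp only [Prod.mk.injEq, Binding.co.injEq, Constr.mk.injEq] at hm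
          obtain ⟨rfl, rfl, rfl, rfl, rfl⟩ := hm
          exact hab.weaken hS hc hΓ' (Finset.inter_subset_right.trans hΔ)
        · exact .assn hc (hΓ' hm) (hΔ (Context.mem_dom hm)) }
  simpa only [Tm.sub_fvar] using h.subst hS .fvar hΓ hm

/-! ### Inversion and regularity -/

theorem Ctx.typing_of_mem (hS : S.WellFormed) {Γ : Context} (h : Ctx S Γ) :
    ∀ {x A}, (x, Binding.tm A) ∈ Γ → Typing S Γ A .star := by
  match h with
  | .empty => intro x A hx; simp at hx
  | .consTm hΓ hA hx =>
    intro y B hy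
    rcases List.mem_cons.1 hy with hy | hy
    · simp only [Prod.mk.injEq, Binding.tm.injEq] at hy
      obtain ⟨rfl, rfl⟩ := hy
      exact hA.weaken hS (.consTm hΓ hA hx) (List.subset_cons_self _ _)
    · exact (hΓ.typing_of_mem hS hy).weaken hS (.consTm hΓ hA hx) (List.subset_cons_self _ _)
  | .consCo hΓ hφ hx =>
    intro y B hy
    exact (hΓ.typing_of_mem hS (by simpa using hy)).weaken hS (.consCo hΓ hφ hx)
      (List.subset_cons_self _ _)

theorem Ctx.propWff_of_mem (hS : S.WellFormed) {Γ : Context} (h : Ctx S Γ) :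
    ∀ {c φ}, (c, Binding.co φ) ∈ Γ → PropWff S Γ φ := by
  match h with
  | .empty => intro c φ hc; simp at hc
  | .consTm hΓ hA hx =>
    intro c φ hc
    exact (hΓ.propWff_of_mem hS (by simpa using hc)).weaken hS (.consTm hΓ hA hx)
      (List.subset_cons_self _ _)
  | .consCo hΓ hφ hx =>
    intro c ψ hc
    rcases List.mem_cons.1 hc with hc | hc
    · simp only [Prod.mk.injEq, Binding.co.injEq] at hc
      obtain ⟨rfl, rfl⟩ := hc
      exact hφ.weaken hS (.consCo hΓ hφ hx) (List.subset_cons_self _ _)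
    · exact (hΓ.propWff_of_mem hS hc).weaken hS (.consCo hΓ hφ hx) (List.subset_cons_self _ _)

/-- A `Π`-type has a well-formed domain and codomain whatever type it is given, since conversion
changes only the latter. -/
theorem Typing.pi_inv {Γ : Context} {a T : Tm} (h : Typing S Γ a T) :
    ∀ {ρ A B}, a = .pi ρ A B → Typing S Γ A .star ∧
      ∃ L : Finset ℕ, ∀ x ∉ L, Typing S ((x, .tm A) :: Γ) (B.at x) .star := by
  match h with
  | .pi L hB hA => rintro _ _ _ ⟨⟩; exact ⟨hA, L, hB⟩
  | .conv h _ _ => intro ρ A B; exact h.pi_inv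
  | .star _ | .var _ _ | .abs _ _ _ _ | .app _ _ | .tapp _ _ _ | .iapp _ _ | .cpi _ _ _
  | .cabs _ _ _ | .capp _ _ | .const _ _ _ | .fam _ _ _ | .case _ _ _ _ _ _ =>
    rintro _ _ _ ⟨⟩

theorem Typing.cpi_inv {Γ : Context} {a₀ T : Tm} (h : Typing S Γ a₀ T) :
    ∀ {a b A R B}, a₀ = .cpi a b A R B → PropWff S Γ ⟨a, b, A, R⟩ ∧
      ∃ L : Finset ℕ, ∀ c ∉ L, Typing S ((c, .co ⟨a, b, A, R⟩) :: Γ) B .star := by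
  match h with
  | .cpi L hB hφ => rintro _ _ _ _ _ ⟨⟩; exact ⟨hφ, L, hB⟩
  | .conv h _ _ => intro a b A R B; exact h.cpi_inv
  | .star _ | .var _ _ | .abs _ _ _ _ | .app _ _ | .tapp _ _ _ | .iapp _ _ | .pi _ _ _
  | .cabs _ _ _ | .capp _ _ | .const _ _ _ | .fam _ _ _ | .case _ _ _ _ _ _ =>
    rintro _ _ _ _ _ ⟨⟩

theorem Typing.pi_inst (hS : S.WellFormed) {Γ : Context} {ρ : Relevance} {A B T u : Tm}
    (h : Typing S Γ (.pi ρ A B) T) (hu : Typing S Γ u A) : Typing S Γ (B.inst u) .star := by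
  obtain ⟨_, L, hB⟩ := h.pi_inv rfl
  exact Typing.inst (T := .star) hS hB hu

theorem Typing.cpi_body (hS : S.WellFormed) {Γ : Context} {a b A B T : Tm} {R : Role}
    (h : Typing S Γ (.cpi a b A R B) T) (hab : DefEq S Γ Γ.dom a b A R) :
    Typing S Γ B .star := by
  obtain ⟨_, L, hB⟩ := h.cpi_inv rfl
  obtain ⟨c, hc⟩ := Infinite.exists_notMem_finset L
  exact (hB c hc).discharge hS h.ctx hab

/-- The type of a well-typed term is itself well typed. -/
theorem Typing.regular (hS : S.WellFormed) {Γ : Context} {a A : Tm} (h : Typing S Γ a A) :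
    Typing S Γ A .star := by
  match h with
  | .star hΓ => exact .star hΓ
  | .var hΓ hx => exact hΓ.typing_of_mem hS hx
  | .pi _ _ hA => exact .star hA.ctx
  | .abs L hb hA _ => exact .pi L (fun x hx => (hb x hx).regular hS) hA
  | .app hb ha => exact (hb.regular hS).pi_inst hS ha
  | .tapp hb ha _ => exact (hb.regular hS).pi_inst hS ha
  | .iapp hb ha => exact (hb.regular hS).pi_inst hS ha
  | .conv _ _ hB => exact hB
  | .cpi _ _ hφ => exact .star hφ.scoped.1
  | .cabs L hb hφ => exact .cpi L (fun c hc => (hb c hc).regular hS) hφ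
  | .capp ha hab => exact (ha.regular hS).cpi_body hS hab
  | .const hΓ _ hA => exact hA.weaken hS hΓ (List.nil_subset _)
  | .fam hΓ _ hA => exact hA.weaken hS hΓ (List.nil_subset _)
  | .case _ _ hb₂ _ _ _ => exact hb₂.regular hS
termination_by structural h

mutual

theorem Iso.regular (hS : S.WellFormed) {Γ : Context} {Δ : Finset ℕ} {φ₁ φ₂ : Constr}
    (h : Iso S Γ Δ φ₁ φ₂) : PropWff S Γ φ₁ ∧ PropWff S Γ φ₂ := by
  match h with
  | .propCong ha hb =>
    obtain ⟨ha₁, ha₂⟩ := ha.regular hS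
    obtain ⟨hb₁, hb₂⟩ := hb.regular hS
    exact ⟨.wff ha₁ hb₁ (ha₁.regular hS), .wff ha₂ hb₂ (ha₁.regular hS)⟩
  | .isoConv _ h₁ h₂ => exact ⟨h₁, h₂⟩
  | .cpiFst h =>
    obtain ⟨h₁, h₂⟩ := h.regular hS
    exact ⟨(h₁.cpi_inv rfl).1, (h₂.cpi_inv rfl).1⟩
termination_by structural h

theorem DefEq.regular (hS : S.WellFormed) {Γ : Context} {Δ : Finset ℕ} {a b A : Tm} {R : Role}
    (h : DefEq S Γ Δ a b A R) : Typing S Γ a A ∧ Typing S Γ b A := by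
  match h with
  | .assn hΓ hc _ =>
    cases hΓ.propWff_of_mem hS hc with
    | wff ha hb _ => exact ⟨ha, hb⟩
  | .refl h => exact ⟨h, h⟩
  | .symm h => exact (h.regular hS).symm
  | .trans h₁ h₂ => exact ⟨(h₁.regular hS).1, (h₂.regular hS).2⟩
  | .sub h _ => exact h.regular hS
  | .beta h₁ h₂ _ => exact ⟨h₁, h₂⟩
  | .piCong _ _ _ _ h₁ h₂ => exact ⟨h₁, h₂⟩
  | .absCong L hb hA h₁ h₂ =>
    exact ⟨.abs L (fun x hx => ((hb x hx).regular hS).1) hA h₁,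
      .abs L (fun x hx => ((hb x hx).regular hS).2) hA h₂⟩
  | .appCong h₁ h₂ =>
    obtain ⟨ha₁, hb₁⟩ := h₁.regular hS
    obtain ⟨ha₂, hb₂⟩ := h₂.regular hS
    have hB := (ha₁.regular hS).pi_inst hS ha₂
    -- The right-hand side has its type at `b₂`, which equals the type at `a₂` because equal
    -- arguments may be put into the two sides of an instance of reflexivity for the `Π`-type.
    have hBB := DefEq.piSnd (.refl (R := .rep) (ha₁.regular hS)) (h₂.dom hS ha₁.ctx)
    exact ⟨.app ha₁ ha₂, .conv (.app hb₁ hb₂) hBB.symm hB⟩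
  | .tappCong h₁ h₂ hR _ h =>
    exact ⟨.tapp (h₁.regular hS).1 (h₂.regular hS).1 hR, h⟩
  | .iappCong h₁ h =>
    exact ⟨.iapp (h₁.regular hS).1 h, .iapp (h₁.regular hS).2 h⟩
  | .piFst h =>
    obtain ⟨h₁, h₂⟩ := h.regular hS
    exact ⟨(h₁.pi_inv rfl).1, (h₂.pi_inv rfl).1⟩
  | .piSnd h₁ h₂ =>
    obtain ⟨hB₁, hB₂⟩ := h₁.regular hS
    obtain ⟨ha₁, ha₂⟩ := h₂.regular hS
    -- `a₂` is typed at `A₁`; injectivity of the `Π`-type converts it to `A₂`.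
    have hA := DefEq.sub (h₁.dom hS hB₁.ctx).piFst (.repTop _)
    exact ⟨hB₁.pi_inst hS ha₁, hB₂.pi_inst hS (.conv ha₂ hA (hB₂.pi_inv rfl).1)⟩
  | .cpiCong _ _ _ _ h₁ h₂ => exact ⟨h₁, h₂⟩
  | .cabsCong L hb hφ =>
    exact ⟨.cabs L (fun c hc => ((hb c hc).regular hS).1) hφ,
      .cabs L (fun c hc => ((hb c hc).regular hS).2) hφ⟩
  | .cappCong h₁ h₂ => exact ⟨.capp (h₁.regular hS).1 h₂, .capp (h₁.regular hS).2 h₂⟩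
  | .cpiSnd h h₁ h₂ =>
    exact ⟨(h.regular hS).1.cpi_body hS h₁, (h.regular hS).2.cpi_body hS h₂⟩
  | .cast _ hφ =>
    cases (hφ.regular hS).2 with
    | wff ha hb _ => exact ⟨ha, hb⟩
  | .eqConv h hAB =>
    have hB := (hAB.regular hS).2
    exact ⟨.conv (h.regular hS).1 hAB hB, .conv (h.regular hS).2 hAB hB⟩
  | .isoSnd hφ =>
    obtain ⟨h₁, h₂⟩ := hφ.regular hS
    cases h₁ with
    | wff _ _ hA =>
      cases h₂ with
      | wff _ _ hA' => exact ⟨hA, hA'⟩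
  | .patCong h h₁ h₂ hF hbr hbr' hB hs =>
    exact ⟨.case (h.regular hS).1 (h₁.regular hS).1 (h₂.regular hS).1 hF hbr hs,
      .case (h.regular hS).2 (.conv (h₁.regular hS).2 hB (hB.regular hS).2) (h₂.regular hS).2 hF
        hbr' hs⟩
  | .leftRel _ _ ha _ ha' _ _ _ => exact ⟨ha, ha'⟩
  | .leftIrrel _ _ ha _ ha' _ _ _ => exact ⟨ha, ha'⟩
  | .right _ _ _ hb _ hb' _ _ => exact ⟨hb, hb'⟩
  | .cLeft _ _ ha ha' _ _ => exact ⟨ha, ha'⟩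
termination_by structural h

end

end SystemDR

theorem mainTheorem7 (S : SystemDR.Signature) (hS : S.WellFormed)
    (Γ : SystemDR.Context) (Δ : Finset ℕ) (a b A : SystemDR.Tm) (R : SystemDR.Role)
    (h : SystemDR.DefEq S Γ Δ a b A R) :
    SystemDR.Typing S Γ a A ∧ SystemDR.Typing S Γ b A :=
  SystemDR.DefEq.regular hS h
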